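/- Let $\mathcal X$ be a finite alphabet, $M>2$, and let $P_1,\dots,P_M$ be probability distributions on $\mathcal X$. All logarithms are natural. For distributions $P,Q$ on $\mathcal X$ and $\alpha\ge 0$ put $$\mathrm{GJS}(P,Q,\alpha)=\alpha D\Big(P\,\Big\|\,\tfrac{\alpha P+Q}{1+\alpha}\Big)+D\Big(Q\,\Big\|\,\tfrac{\alpha P+Q}{1+\alpha}\Big),\qquad C(P,Q)=-\inf_{\eta\in[0,1]}\log\sum_{x}P(x)^{\eta}Q(x)^{1-\eta}\in[0,\infty],$$ where $D$ is relative entropy. Under hypothesis $H_i$ ($i\in[M]$) one has training sequences $X_1^N,\dots,X_M^N$ of length $N$ and a test sequence $Y_1,Y_2,\dots$, all samples being independent, those of $X_j^N$ with law $P_j$ and those of $Y$ with law $P_i$; the corresponding probability and expectation are $\mathrm P_i$ and $\mathbb E_i$. Write $\hat P_{x^n}$ for the empirical distribution of a sequence $x^n$. For a threshold $\gamma\ge0$ let $$\Psi_n=\Big\{i\in[M]:\ \exists\,1\le k\le n,\ k\,\mathrm{GJS}\big(\hat P_{X_i^N},\hat P_{Y^k},\tfrac Nk\big)\ge\gamma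 N\Big\},\qquad T=\inf\{n\ge1:|\Psi_n|\ge M-1\}\wedge N^2,\qquad d=[M]\setminus\Psi_T .$$ The test stops at time $T$ and declares $H_i$ if $d=\{i\}$; its error probability under $H_i$ is $P_{\mathrm{err},i}=\mathrm P_i(d\neq\{i\})$, and its error exponent is $$e_i=\liminf_{N\to\infty}\frac{-\log P_{\mathrm{err},i}}{\mathbb E_i[T]}\qquad(-\log 0=\infty).$$ Suppose that $0\le\gamma\le\min_{i\ne j}C(P_i,P_j)$, and that $P_i$ and $P_j$ have the same support whenever $i\neq j$ and $\gamma=C(P_i,P_j)$ (this holds in particular if all $P_i$ have full support). If $\gamma>0$, then for all $i\ne j$ the equation $$\mathrm{GJS}\big(P_j,P_i,\theta\big)=\gamma\,\theta$$ has exactly one solution $\theta=\theta^\star_{i(j),\gamma}>0$, and $P_{\mathrm{err},i}\to0$ as $N\to\infty$ for every $i$. Moreover, for every $\gamma$ as above (where, for $\gamma=0$, $\theta^\star_{i(j),\gamma}$ is any solution $\theta\ge0$) and every $i\in[M]$, $$e_i\ \ge\ \min_{j\ne i}\mathrm{GJS}\big(P_j,P_i,\theta^\star_{i(j),\gamma}\big).$$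 -/

import Mathlib

open Filter Topology MeasureTheory

namespace SeqClass

noncomputable section

/-- Relative entropy `∑ P(a) log (P(a) / Q(a))` (natural logarithm) of two mass functions on a finite
alphabet. It is only used below with `P` absolutely continuous with respect to `Q`, or multiplied
by `0`, so the convention `x / 0 = 0` plays no role. -/
def kl {X : Type*} [Fintype X] (P Q : X → ℝ) : ℝ :=
  ∑ a, P a * Real.log (P a / Q a)

/-- The mixture `(α P + Q) / (1 + α)`. -/
def mix {X : Type*} (P Q : X → ℝ) (α : ℝ) : X → ℝ :=
  fun a => (α * P a + Q a) / (1 + α)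

/-- Generalized Jensen-Shannon divergence `GJS(P, Q, α)`. -/
def gjs {X : Type*} [Fintype X] (P Q : X → ℝ) (α : ℝ) : ℝ :=
  α * kl P (mix P Q α) + kl Q (mix P Q α)

/-- The mass function of a distribution, with real values. -/
def mass {X : Type*} (P : PMF X) : X → ℝ := fun a => (P a).toReal

/-- Chernoff information `- min_{η ∈ [0,1]} log ∑ P(x)^η Q(x)^(1-η)`; it is `⊤` exactly when the
supports are disjoint. -/
def chernoff {X : Type*} [Fintype X] (P Q : PMF X) : EReal :=
  -⨅ η : Set.Icc (0 : ℝ) 1, ENNReal.log (∑ x, P x ^ (η : ℝ) * Q x ^ (1 - (η : ℝ)))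

/-- `θ` is the solution in `[0, ∞)` of `GJS(P, Q, θ) = γ θ`, the trivial solution `θ = 0` being
discarded when `γ > 0`. -/
def IsThetaStar {X : Type*} [Fintype X] (P Q : PMF X) (γ θ : ℝ) : Prop :=
  0 ≤ θ ∧ (0 < γ → 0 < θ) ∧ gjs (mass P) (mass Q) θ = γ * θ

/-- Type (empirical distribution) of a sequence of length `n`. -/
def empDist {X : Type*} [DecidableEq X] {n : ℕ} (x : Fin n → X) : X → ℝ :=
  fun a => (1 / (n : ℝ)) * ∑ k, if x k = a then 1 else 0

/-- Observations: `M` training sequences of length `N`, and the infinite sequence of test samples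
(`y 0` is the first test sample). -/
abbrev Obs (X : Type*) (M N : ℕ) : Type _ := (Fin M → Fin N → X) × (ℕ → X)

/-- The law under hypothesis `i`: all samples are independent, the `j`-th training sequence has
i.i.d. entries of law `P j`, and the test samples are i.i.d. of law `P i`. -/
def law {X : Type*} [MeasurableSpace X] {M : ℕ} (P : Fin M → PMF X) (N : ℕ) (i : Fin M) :
    Measure (Obs X M N) :=
  (Measure.pi fun j => Measure.pi fun _ : Fin N => (P j).toMeasure).prod
    (Measure.infinitePi fun _ : ℕ => (P i).toMeasure)

/-- The score `k GJS(X_i^N, Y^k, N / k)` of class `i` at time `k`. -/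
def score {X : Type*} [Fintype X] [DecidableEq X] {M N : ℕ} (ω : Obs X M N) (i : Fin M) (k : ℕ) :
    ℝ :=
  k * gjs (empDist (ω.1 i)) (empDist fun m : Fin k => ω.2 m) ((N : ℝ) / k)

/-- The set `Ψ_n` of classes whose score has reached the threshold `γ N` up to time `n`. -/
def Psi {X : Type*} [Fintype X] [DecidableEq X] {M N : ℕ} (γ : ℝ) (ω : Obs X M N) (n : ℕ) :
    Set (Fin M) :=
  {i | ∃ k, 1 ≤ k ∧ k ≤ n ∧ γ * N ≤ score ω i k}

/-- The stopping time `inf {n ≥ 1 : |Ψ_n| ≥ M - 1} ∧ N ^ 2`. The minimum with `N ^ 2` is taken by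
inserting `N ^ 2` into the set, so that the infimum of the empty set does not occur. -/
def stopTime {X : Type*} [Fintype X] [DecidableEq X] {M N : ℕ} (γ : ℝ) (ω : Obs X M N) : ℕ :=
  sInf (insert (N ^ 2) {n : ℕ | 1 ≤ n ∧ M - 1 ≤ (Psi γ ω n).ncard})

/-- The terminal decision `[M] \ Ψ_T`; it declares class `i` when it equals `{i}`. -/
def decision {X : Type*} [Fintype X] [DecidableEq X] {M N : ℕ} (γ : ℝ) (ω : Obs X M N) :
    Set (Fin M) :=
  (Psi γ ω (stopTime γ ω))ᶜ

/-- The error probability under hypothesis `i` with training sequences of length `N`. -/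
def errProb {X : Type*} [Fintype X] [DecidableEq X] [MeasurableSpace X] {M : ℕ}
    (P : Fin M → PMF X) (γ : ℝ) (i : Fin M) (N : ℕ) : ENNReal :=
  law P N i {ω | decision γ ω ≠ {i}}

/-- The expected number of test samples under hypothesis `i`. -/
def expTime {X : Type*} [Fintype X] [DecidableEq X] [MeasurableSpace X] {M : ℕ}
    (P : Fin M → PMF X) (γ : ℝ) (i : Fin M) (N : ℕ) : ENNReal :=
  ∫⁻ ω, (stopTime γ ω : ENNReal) ∂(law P N i)

/-- The error exponent `liminf_N (- log P_err,i) / E_i[T]`, in `[-∞, ∞]` with `- log 0 = ∞`. -/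
def errExponent {X : Type*} [Fintype X] [DecidableEq X] [MeasurableSpace X] {M : ℕ}
    (P : Fin M → PMF X) (γ : ℝ) (i : Fin M) : EReal :=
  liminf (fun N : ℕ => (-ENNReal.log (errProb P γ i N)) / (expTime P γ i N : EReal)) atTop

end

end SeqClass

open SeqClass

/-!
The score is symmetric up to scaling, `k GJS(P, Q, N / k) = N GJS(Q, P, k / N)`, and its negative
exponential is the likelihood of the two sequences under the mixture of their types divided by
their maximal likelihood. Maximal likelihoods sum to a polynomial, because there are only
polynomially many types, so the true class reaches `γ N` by time `N ^ 2` with probability at most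
`poly(N) e ^ (-γ N)`.

For a wrong class `j`, tilt the likelihood by an exponent `η` towards the mixture `V` of the
types: a score below `γ N` at time `k` costs at most the power `1 / η` of
`e ^ ((1 - η) γ N) B(P_j, V) ^ N B(P_i, V) ^ k`, where `B` is the Bhattacharyya coefficient of
order `η`. At the deadline `k = N ^ 2`, which is much larger than `N`, the last factor forces `V`
to be near `P_i`, where `B(P_j, V)` is about `B(P_j, P_i) ≤ e ^ (-γ)`; hence the error probability
is at most `e ^ (-(γ - o(1)) N)`. At `k = c N` with `GJS(P_i, P_j, c) > γ`, compactness makes a low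
score exponentially unlikely, so `E[T] ≤ c N + O(1)`. The exponent is therefore at least `γ / c`,
and letting `c` decrease to `1 / min θ` gives `γ min θ`, which is the smallest `GJS(P_j, P_i, θ)`.
-/

namespace SeqClass

noncomputable section

open Function (support)

/-! ### Relative entropy and Bhattacharyya coefficients -/

section Divergence

variable {X : Type*} [Fintype X] {p q V : X → ℝ} {α η : ℝ}

lemma mul_log_div_add {x y z : ℝ} (hy : x ≠ 0 → y ≠ 0) (hz : x ≠ 0 → z ≠ 0) :
    x * Real.log (x / y) + x * Real.log (y / z) = x * Real.log (x / z) := by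
  rcases eq_or_ne x 0 with rfl | hx
  · simp
  · rw [← mul_add, ← Real.log_mul (div_ne_zero hx (hy hx)) (div_ne_zero (hy hx) (hz hx)),
      div_mul_div_cancel₀ (hy hx)]

lemma kl_self (p : X → ℝ) : kl p p = 0 :=
  Finset.sum_eq_zero fun a _ => by by_cases h : p a = 0 <;> simp [h]

lemma exp_neg_kl_le_sum {h : X → ℝ} (hp : p ∈ stdSimplex ℝ X) (hh : 0 ≤ h)
    (hph : support p ⊆ support h) : Real.exp (-kl p h) ≤ ∑ a, h a := by
  have jensen := convexOn_exp.map_sum_le (t := Finset.univ) (w := p)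
    (p := fun a => -Real.log (p a / h a)) (fun a _ => hp.1 a) hp.2 (fun _ _ => Set.mem_univ _)
  simp only [smul_eq_mul, mul_neg, Finset.sum_neg_distrib] at jensen
  refine jensen.trans (Finset.sum_le_sum fun a _ => ?_)
  rcases (hp.1 a).eq_or_lt with hpa | hpa
  · rw [← hpa, zero_mul]
    exact hh a
  · have hha : 0 < h a := (hh a).lt_of_ne' (hph hpa.ne')
    rw [← Real.log_inv, inv_div, Real.exp_log (div_pos hha hpa), mul_div_cancel₀ _ hpa.ne']

lemma kl_nonneg (hp : p ∈ stdSimplex ℝ X) (hV : V ∈ stdSimplex ℝ X)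
    (hpV : support p ⊆ support V) : 0 ≤ kl p V := by
  have gibbs := exp_neg_kl_le_sum hp hV.1 hpV
  rwa [hV.2, Real.exp_le_one_iff, neg_nonpos] at gibbs

/-- The Bhattacharyya coefficient `∑ p ^ η q ^ (1 - η)` of order `η`, whose logarithm the Chernoff
information minimizes. It also measures how unlikely `q`-samples are to look like `p`. -/
def bhat (η : ℝ) (p q : X → ℝ) : ℝ := ∑ a, p a ^ η * q a ^ (1 - η)

lemma bhat_self (hp : p ∈ stdSimplex ℝ X) : bhat η p p = 1 := by
  have hη : η + (1 - η) = 1 := add_sub_cancel η 1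
  rw [← hp.2]
  exact Finset.sum_congr rfl fun a _ => by
    rw [← Real.rpow_add' (hp.1 a) (hη.trans_ne one_ne_zero), hη, Real.rpow_one]

lemma bhat_nonneg (hp : 0 ≤ p) (hq : 0 ≤ q) : 0 ≤ bhat η p q :=
  Finset.sum_nonneg fun a _ => mul_nonneg (Real.rpow_nonneg (hp a) _) (Real.rpow_nonneg (hq a) _)

lemma bhat_le_one (hη : η ∈ Set.Icc 0 1) (hp : p ∈ stdSimplex ℝ X) (hq : q ∈ stdSimplex ℝ X) :
    bhat η p q ≤ 1 := by
  calc bhat η p q ≤ ∑ a, (η * p a + (1 - η) * q a) := Finset.sum_le_sum fun a _ =>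
        Real.geom_mean_le_arith_mean2_weighted hη.1 (sub_nonneg.2 hη.2) (hp.1 a) (hq.1 a)
          (add_sub_cancel η 1)
    _ = 1 := by
        rw [Finset.sum_add_distrib, ← Finset.mul_sum, ← Finset.mul_sum, hp.2, hq.2]
        ring

lemma bhat_lt_one (hη : η ∈ Set.Ioo 0 1) (hp : p ∈ stdSimplex ℝ X) (hq : q ∈ stdSimplex ℝ X)
    (hne : p ≠ q) : bhat η p q < 1 := by
  obtain ⟨b, hb⟩ := Function.ne_iff.1 hne
  calc bhat η p q < ∑ a, (η * p a + (1 - η) * q a) := Finset.sum_lt_sum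
        (fun a _ => Real.geom_mean_le_arith_mean2_weighted hη.1.le (sub_nonneg.2 hη.2.le)
          (hp.1 a) (hq.1 a) (add_sub_cancel η 1))
        ⟨b, Finset.mem_univ b, (Real.geom_mean_lt_arith_mean2_weighted_iff_of_pos hη.1
          (sub_pos.2 hη.2) (hp.1 b) (hq.1 b) (add_sub_cancel η 1)).2 hb⟩
    _ = 1 := by
        rw [Finset.sum_add_distrib, ← Finset.mul_sum, ← Finset.mul_sum, hp.2, hq.2]
        ring

lemma continuous_bhat_left (hη : 0 ≤ η) (q : X → ℝ) : Continuous fun p => bhat η p q :=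
  continuous_finsetSum _ fun a _ =>
    ((continuous_apply a).rpow_const fun _ => Or.inr hη).mul continuous_const

lemma continuous_bhat_right (hη : η ≤ 1) (p : X → ℝ) : Continuous (bhat η p) :=
  continuous_finsetSum _ fun a _ =>
    continuous_const.mul ((continuous_apply a).rpow_const fun _ => Or.inr (sub_nonneg.2 hη))

lemma exp_neg_kl_le_bhat (hp : p ∈ stdSimplex ℝ X) (hq : 0 ≤ q)
    (hpq : support p ⊆ support q) : Real.exp (-((1 - η) * kl p q)) ≤ bhat η p q := by
  have hkl : kl p (fun a => p a ^ η * q a ^ (1 - η)) = (1 - η) * kl p q := by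
    simp only [kl, Finset.mul_sum]
    refine Finset.sum_congr rfl fun a _ => ?_
    rcases (hp.1 a).eq_or_lt with hpa | hpa
    · simp [← hpa]
    · have hqa : 0 < q a := (hq a).lt_of_ne' (hpq hpa.ne')
      rw [Real.log_div hpa.ne' (by positivity), Real.log_mul (by positivity) (by positivity),
        Real.log_rpow hpa, Real.log_rpow hqa, Real.log_div hpa.ne' hqa.ne']
      ring
  rw [← hkl]
  refine exp_neg_kl_le_sum hp
    (fun a => mul_nonneg (Real.rpow_nonneg (hp.1 a) _) (Real.rpow_nonneg (hq a) _)) fun a ha => ?_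
  have hpa : 0 < p a := (hp.1 a).lt_of_ne' ha
  have hqa : 0 < q a := (hq a).lt_of_ne' (hpq ha)
  exact ne_of_gt (by positivity)

lemma kl_pos (hp : p ∈ stdSimplex ℝ X) (hV : V ∈ stdSimplex ℝ X)
    (hpV : support p ⊆ support V) (hne : p ≠ V) : 0 < kl p V := by
  have hexp := (exp_neg_kl_le_bhat (η := 1 / 2) hp hV.1 hpV).trans_lt
    (bhat_lt_one (by norm_num) hp hV hne)
  rw [Real.exp_lt_one_iff] at hexp
  linarith

end Divergence

/-! ### The generalized Jensen-Shannon divergence -/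

section JensenShannon

variable {X : Type*} {p q V : X → ℝ} {α : ℝ}

lemma support_subset_support_mix_left (hp : 0 ≤ p) (hq : 0 ≤ q) (hα : 0 < α) :
    support p ⊆ support (mix p q α) := fun a ha => by
  have hpa : 0 < p a := (hp a).lt_of_ne' ha
  have hqa : 0 ≤ q a := hq a
  exact (by positivity : 0 < (α * p a + q a) / (1 + α)).ne'

lemma support_subset_support_mix_right (hp : 0 ≤ p) (hq : 0 ≤ q) (hα : 0 ≤ α) :
    support q ⊆ support (mix p q α) := fun a ha => by
  have hpa : 0 ≤ p a := hp a
  have hqa : 0 < q a := (hq a).lt_of_ne' ha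
  exact (by positivity : 0 < (α * p a + q a) / (1 + α)).ne'

lemma support_mix_subset (hpV : support p ⊆ support V) (hqV : support q ⊆ support V) :
    support (mix p q α) ⊆ support V := by
  intro a ha
  by_contra hV
  exact ha (by simp [mix, Function.notMem_support.1 fun h => hV (hpV h),
    Function.notMem_support.1 fun h => hV (hqV h)])

lemma mix_inv (hα : α ≠ 0) : mix p q α⁻¹ = mix q p α := by
  funext a
  rw [mix, ← mul_div_mul_left _ _ hα, mul_add, mul_add, mul_inv_cancel_left₀ hα,
    mul_inv_cancel₀ hα, mul_one, add_comm, add_comm α, mix]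

lemma tendsto_mix_atTop : Tendsto (mix p q) atTop (𝓝 p) := by
  refine tendsto_pi_nhds.2 fun a => ?_
  have hinv : Tendsto (fun α : ℝ => (q a - p a) / (1 + α)) atTop (𝓝 0) :=
    tendsto_const_nhds.div_atTop (tendsto_atTop_add_const_left _ 1 tendsto_id)
  refine ((hinv.const_add (p a)).congr' ?_).trans_eq (by rw [add_zero])
  filter_upwards [eventually_gt_atTop 0] with α hα
  rw [mix]
  field_simp
  ring

variable [Fintype X]

lemma mix_mem_stdSimplex (hp : p ∈ stdSimplex ℝ X) (hq : q ∈ stdSimplex ℝ X) (hα : 0 ≤ α) :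
    mix p q α ∈ stdSimplex ℝ X := by
  refine ⟨fun a => ?_, ?_⟩
  · have := hp.1 a
    have := hq.1 a
    simp only [mix]
    positivity
  · simp only [mix]
    rw [← Finset.sum_div, Finset.sum_add_distrib, ← Finset.mul_sum, hp.2, hq.2, mul_one, add_comm,
      div_self (by positivity)]

lemma gjs_inv (hα : α ≠ 0) : gjs p q α⁻¹ = α⁻¹ * gjs q p α := by
  rw [gjs, gjs, mix_inv hα, mul_add, inv_mul_cancel_left₀ hα, add_comm]

lemma gjs_eq_mul_gjs_inv (hα : α ≠ 0) : gjs p q α = α * gjs q p α⁻¹ := by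
  rw [gjs_inv hα, mul_inv_cancel_left₀ hα]

lemma gjs_zero : gjs p q 0 = 0 := by
  have hmix : mix p q 0 = q := funext fun a => by simp [mix]
  rw [gjs, hmix, kl_self, zero_mul, zero_add]

lemma gjs_add_mul_kl_mix (hp : 0 ≤ p) (hq : 0 ≤ q) (hα : 0 < α)
    (hpV : support p ⊆ support V) (hqV : support q ⊆ support V) :
    gjs p q α + (1 + α) * kl (mix p q α) V = α * kl p V + kl q V := by
  simp only [gjs, kl, Finset.mul_sum, ← Finset.sum_add_distrib]
  refine Finset.sum_congr rfl fun a _ => ?_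
  have hmix : (1 + α) * mix p q α a = α * p a + q a := mul_div_cancel₀ _ (by positivity)
  have hpa := mul_log_div_add (x := p a)
    (fun ha => support_subset_support_mix_left hp hq hα ha) (fun ha => hpV ha)
  have hqa := mul_log_div_add (x := q a)
    (fun ha => support_subset_support_mix_right hp hq hα.le ha) (fun ha => hqV ha)
  linear_combination hmix * Real.log (mix p q α a / V a) + α * hpa + hqa

lemma gjs_le (hp : p ∈ stdSimplex ℝ X) (hq : q ∈ stdSimplex ℝ X) (hV : V ∈ stdSimplex ℝ X)
    (hα : 0 < α) (hpV : support p ⊆ support V) (hqV : support q ⊆ support V) :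
    gjs p q α ≤ α * kl p V + kl q V := by
  rw [← gjs_add_mul_kl_mix hp.1 hq.1 hα hpV hqV]
  have := kl_nonneg (mix_mem_stdSimplex hp hq hα.le) hV (support_mix_subset hpV hqV)
  exact le_add_of_nonneg_right (by positivity)

lemma monotoneOn_gjs (hp : p ∈ stdSimplex ℝ X) (hq : q ∈ stdSimplex ℝ X) :
    MonotoneOn (gjs p q) (Set.Ioi 0) := by
  intro α hα β hβ hαβ
  rw [Set.mem_Ioi] at hα hβ
  have hm := mix_mem_stdSimplex hp hq hβ.le
  have hpm := support_subset_support_mix_left hp.1 hq.1 hβ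
  have hkl := kl_nonneg hp hm hpm
  calc gjs p q α ≤ α * kl p (mix p q β) + kl q (mix p q β) :=
        gjs_le hp hq hm hα hpm (support_subset_support_mix_right hp.1 hq.1 hβ.le)
    _ ≤ gjs p q β := by rw [gjs]; gcongr

lemma strictMonoOn_gjs (hp : p ∈ stdSimplex ℝ X) (hq : q ∈ stdSimplex ℝ X) (hne : p ≠ q) :
    StrictMonoOn (gjs p q) (Set.Ioi 0) := by
  intro α hα β hβ hαβ
  rw [Set.mem_Ioi] at hα hβ
  have hm := mix_mem_stdSimplex hp hq hβ.le
  have hpm := support_subset_support_mix_left hp.1 hq.1 hβ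
  have hkl : 0 < kl p (mix p q β) := by
    refine kl_pos hp hm hpm fun h => hne (funext fun a => ?_)
    have ha := congrFun h a
    rw [mix, eq_div_iff (by positivity)] at ha
    linarith
  calc gjs p q α ≤ α * kl p (mix p q β) + kl q (mix p q β) :=
        gjs_le hp hq hm hα hpm (support_subset_support_mix_right hp.1 hq.1 hβ.le)
    _ < gjs p q β := by rw [gjs]; gcongr

lemma mul_log_div_eq_neg_negMulLog_sub {x y : ℝ} (h : x ≠ 0 → y ≠ 0) :
    x * Real.log (x / y) = -Real.negMulLog x - x * Real.log y := by
  rcases eq_or_ne x 0 with rfl | hx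
  · simp
  · rw [Real.log_div hx (h hx), Real.negMulLog]
    ring

lemma gjs_eq_sum_negMulLog (hp : 0 ≤ p) (hq : 0 ≤ q) (hα : 0 ≤ α) :
    gjs p q α = ∑ a, ((1 + α) * Real.negMulLog (mix p q α a) - α * Real.negMulLog (p a) -
      Real.negMulLog (q a)) := by
  rcases hα.eq_or_lt with rfl | hα
  · simp [gjs_zero, mix]
  simp only [gjs, kl, Finset.mul_sum, ← Finset.sum_add_distrib]
  refine Finset.sum_congr rfl fun a _ => ?_
  have hmix : (1 + α) * mix p q α a = α * p a + q a := mul_div_cancel₀ _ (by positivity)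
  rw [mul_log_div_eq_neg_negMulLog_sub fun ha => support_subset_support_mix_left hp hq hα ha,
    mul_log_div_eq_neg_negMulLog_sub fun ha => support_subset_support_mix_right hp hq hα.le ha,
    Real.negMulLog.eq_1 (mix p q α a)]
  linear_combination Real.log (mix p q α a) * hmix

lemma continuousOn_gjs (hp : 0 ≤ p) (hq : 0 ≤ q) : ContinuousOn (gjs p q) (Set.Ici 0) := by
  refine ContinuousOn.congr (continuousOn_finsetSum _ fun a _ => ?_)
    fun α hα => gjs_eq_sum_negMulLog hp hq hα
  have hmix : ContinuousOn (fun α => mix p q α a) (Set.Ici 0) :=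
    ContinuousOn.div (by fun_prop) (by fun_prop) fun α (hα : 0 ≤ α) => by positivity
  have hlog := Real.continuous_negMulLog.comp_continuousOn' hmix
  fun_prop

lemma continuousOn_gjs_prod (hα : 0 ≤ α) :
    ContinuousOn (fun z : (X → ℝ) × (X → ℝ) => gjs z.1 z.2 α)
      (stdSimplex ℝ X ×ˢ stdSimplex ℝ X) := by
  refine ContinuousOn.congr (Continuous.continuousOn ?_)
    fun z hz => gjs_eq_sum_negMulLog hz.1.1 hz.2.1 hα
  have := Real.continuous_negMulLog
  simp only [mix]
  fun_prop

end JensenShannon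

/-! ### Separation of two distributions -/

section Separation

variable {X : Type*} [Fintype X] {p q : X → ℝ} {b c γ η : ℝ}

/-- Some order `η` *strictly inside* `[0, 1]` witnesses `γ ≤ C(p, q)`. The tilting and compactness
arguments need both exponents `η` and `1 - η` to be positive, whereas the minimum in the definition
of `C(p, q)` may be attained only at an endpoint. -/
def ChernoffSeparated (γ : ℝ) (p q : X → ℝ) : Prop :=
  ∃ η ∈ Set.Ioo (0 : ℝ) 1, bhat η p q ≤ Real.exp (-γ)

lemma ChernoffSeparated.ne (h : ChernoffSeparated γ p q) (hp : p ∈ stdSimplex ℝ X) (hγ : 0 < γ) :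
    p ≠ q := by
  rintro rfl
  obtain ⟨η, -, hb⟩ := h
  rw [bhat_self hp, Real.one_le_exp_iff] at hb
  linarith

lemma ChernoffSeparated.exists_lt_gjs (h : ChernoffSeparated γ p q) (hp : p ∈ stdSimplex ℝ X)
    (hq : q ∈ stdSimplex ℝ X) (hγ : 0 < γ) : ∃ α, 0 < α ∧ γ < gjs q p α := by
  obtain ⟨η, hη, hb⟩ := h
  have hlt : bhat η p q < Real.exp (-((1 - η) * γ)) :=
    hb.trans_lt (Real.exp_lt_exp.2 (by linarith [mul_pos hη.1 hγ]))
  have hlim : Tendsto (fun α => bhat η p (mix q p α)) atTop (𝓝 (bhat η p q)) :=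
    ((continuous_bhat_right hη.2.le p).tendsto q).comp tendsto_mix_atTop
  obtain ⟨α, hα, hα0⟩ := ((hlim.eventually_lt_const hlt).and (eventually_gt_atTop 0)).exists
  have hm := mix_mem_stdSimplex hq hp hα0.le
  have hpm := support_subset_support_mix_right hq.1 hp.1 hα0.le
  have hkl : γ < kl p (mix q p α) := by
    have hexp := (exp_neg_kl_le_bhat hp hm.1 hpm).trans_lt hα
    rw [Real.exp_lt_exp, neg_lt_neg_iff] at hexp
    exact (mul_lt_mul_iff_right₀ (sub_pos.2 hη.2)).1 hexp
  have hkl' := kl_nonneg hq hm (support_subset_support_mix_left hq.1 hp.1 hα0)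
  refine ⟨α, hα0, ?_⟩
  rw [gjs]
  exact hkl.trans_le (le_add_of_nonneg_left (by positivity))

lemma ChernoffSeparated.existsUnique_gjs_eq (h : ChernoffSeparated γ p q)
    (hp : p ∈ stdSimplex ℝ X) (hq : q ∈ stdSimplex ℝ X) (hγ : 0 < γ) :
    ∃! α, 0 < α ∧ gjs q p α = γ := by
  obtain ⟨β, hβ, hγβ⟩ := h.exists_lt_gjs hp hq hγ
  obtain ⟨α, hα, hroot⟩ := intermediate_value_Ioo hβ.le
    ((continuousOn_gjs hq.1 hp.1).mono Set.Icc_subset_Ici_self) ⟨gjs_zero.trans_lt hγ, hγβ⟩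
  exact ⟨α, ⟨hα.1, hroot⟩, fun α' hα' => (strictMonoOn_gjs hq hp (h.ne hp hγ).symm).injOn
    hα'.1 hα.1 (hα'.2.trans hroot.symm)⟩

lemma exists_mem_Ico_forall_le {Z : Type*} [TopologicalSpace Z] {S : Set Z} {f : Z → ℝ}
    (hS : IsCompact S) (hf : ContinuousOn f S) (hlt : ∀ z ∈ S, f z < 1) :
    ∃ r ∈ Set.Ico (0 : ℝ) 1, ∀ z ∈ S, f z ≤ r := by
  obtain ⟨r, hr, hfr⟩ : ∃ r : ℝ, r < 1 ∧ ∀ z ∈ S, f z ≤ r :=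
    IsCompact.exists_forall_le' (α := ℝᵒᵈ) hS hf hlt
  exact ⟨max r 0, ⟨le_max_right r 0, max_lt hr one_pos⟩,
    fun z hz => (hfr z hz).trans (le_max_left r 0)⟩

lemma bhat_pow_mul_bhat_pow_le {V : X → ℝ} {K N k : ℕ} (hη : η ∈ Set.Icc 0 1) (hp : 0 ≤ p)
    (hq : q ∈ stdSimplex ℝ X) (hV : V ∈ stdSimplex ℝ X) (hKN : K * N ≤ k)
    (hb : bhat η p V * bhat η q V ^ K ≤ b) : bhat η p V ^ N * bhat η q V ^ k ≤ b ^ N := by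
  have hpV := bhat_nonneg (η := η) hp hV.1
  have hqV := bhat_nonneg (η := η) hq.1 hV.1
  calc bhat η p V ^ N * bhat η q V ^ k ≤ bhat η p V ^ N * bhat η q V ^ (K * N) := by
        gcongr ?_ * ?_
        exact pow_le_pow_of_le_one hqV (bhat_le_one hη hq hV) hKN
    _ = (bhat η p V * bhat η q V ^ K) ^ N := by rw [pow_mul, ← mul_pow]
    _ ≤ b ^ N := by gcongr

-- Away from `q` the factor `bhat η q V ^ K` is small; near `q` the factor `bhat η p V` is below
-- `b`.
lemma exists_bhat_mul_bhat_pow_le (hη : η ∈ Set.Ioo 0 1) (hp : p ∈ stdSimplex ℝ X)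
    (hq : q ∈ stdSimplex ℝ X) (hb : 0 < b) (hpq : bhat η p q < b) :
    ∃ K : ℕ, ∀ V ∈ stdSimplex ℝ X, bhat η p V * bhat η q V ^ K ≤ b := by
  have hη' := Set.Ioo_subset_Icc_self hη
  have hcont := continuous_bhat_right (X := X) hη.2.le
  obtain ⟨r, hr, hfar⟩ := exists_mem_Ico_forall_le
    ((isCompact_stdSimplex ℝ X).inter_right (isClosed_le continuous_const (hcont p)))
    (hcont q).continuousOn fun V (hV : V ∈ stdSimplex ℝ X ∩ {V | b ≤ bhat η p V}) =>
      bhat_lt_one hη hq hV.1 (by rintro rfl; exact hpq.not_ge hV.2)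
  obtain ⟨K, hK⟩ := exists_pow_lt_of_lt_one hb hr.2
  refine ⟨K, fun V hV => ?_⟩
  have hpV := bhat_nonneg (η := η) hp.1 hV.1
  have hqV := bhat_nonneg (η := η) hq.1 hV.1
  rcases le_total b (bhat η p V) with hbV | hbV
  · calc bhat η p V * bhat η q V ^ K ≤ 1 * r ^ K := by
          gcongr
          exacts [bhat_le_one hη' hp hV, hfar V ⟨hV, hbV⟩]
      _ ≤ b := by linarith
  · exact (mul_le_of_le_one_right hpV (pow_le_one₀ hqV (bhat_le_one hη' hq hV))).trans hbV

lemma bhat_rpow_mul_bhat_lt_one {p' q' : X → ℝ} (hη : η ∈ Set.Ioo 0 1) (hc : 0 < c)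
    (hp : p ∈ stdSimplex ℝ X) (hq : q ∈ stdSimplex ℝ X) (hp' : p' ∈ stdSimplex ℝ X)
    (hq' : q' ∈ stdSimplex ℝ X) (hne : (p', q') ≠ (p, q)) :
    bhat η p' p ^ c * bhat η q' q < 1 := by
  have hη' := Set.Ioo_subset_Icc_self hη
  have hpb := bhat_nonneg (η := η) hp'.1 hp.1
  have hqb := bhat_nonneg (η := η) hq'.1 hq.1
  rcases eq_or_ne p' p with rfl | hpne
  · refine mul_lt_one_of_nonneg_of_lt_one_right ?_ hqb
      (bhat_lt_one hη hq' hq fun h => hne (by rw [h]))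
    exact Real.rpow_le_one hpb (bhat_le_one hη' hp' hp) hc.le
  · exact mul_lt_one_of_nonneg_of_lt_one_left (by positivity)
      (Real.rpow_lt_one hpb (bhat_lt_one hη hp' hp hpne) hc) (bhat_le_one hη' hq' hq)

lemma exists_bhat_rpow_mul_bhat_le_of_lt_gjs (hη : η ∈ Set.Ioo 0 1) (hc : 0 < c)
    (hp : p ∈ stdSimplex ℝ X) (hq : q ∈ stdSimplex ℝ X) (h : γ < gjs p q c) :
    ∃ r ∈ Set.Ico (0 : ℝ) 1, ∀ p' ∈ stdSimplex ℝ X, ∀ q' ∈ stdSimplex ℝ X, gjs p' q' c ≤ γ →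
      bhat η p' p ^ c * bhat η q' q ≤ r := by
  have hcompact := (isCompact_stdSimplex ℝ X).prod (isCompact_stdSimplex ℝ X)
  have hclosed := (continuousOn_gjs_prod hc.le).preimage_isClosed_of_isClosed hcompact.isClosed
    (isClosed_Iic (a := γ))
  have hcont : Continuous fun z : (X → ℝ) × (X → ℝ) => bhat η z.1 p ^ c * bhat η z.2 q := by
    have hbhat := continuous_bhat_left (X := X) hη.1.le
    exact (((hbhat p).comp continuous_fst).rpow_const fun _ => Or.inr hc.le).mul
      ((hbhat q).comp continuous_snd)
  obtain ⟨r, hr, hle⟩ := exists_mem_Ico_forall_le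
    (hcompact.of_isClosed_subset hclosed Set.inter_subset_left) hcont.continuousOn fun z hz =>
      bhat_rpow_mul_bhat_lt_one hη hc hp hq hz.1.1 hz.1.2 fun hzpq => by
        obtain ⟨rfl, rfl⟩ := Prod.mk.inj hzpq
        exact h.not_ge hz.2
  exact ⟨r, hr, fun p' hp' q' hq' hle' => hle (p', q') ⟨⟨hp', hq'⟩, hle'⟩⟩

end Separation

/-! ### The method of types -/

section Types

variable {X : Type*} {n : ℕ}

/-- The likelihood of a sequence under independent sampling from the weights `f`, which need not be
normalized. -/
def lik (f : X → ℝ) (x : Fin n → X) : ℝ := ∏ k, f (x k)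

lemma lik_nonneg {f : X → ℝ} (hf : 0 ≤ f) (x : Fin n → X) : 0 ≤ lik f x :=
  Finset.prod_nonneg fun _ _ => hf _

lemma sum_lik [Fintype X] (f : X → ℝ) (n : ℕ) : ∑ x : Fin n → X, lik f x = (∑ a, f a) ^ n := by
  rw [Finset.sum_pow', Fintype.piFinset_univ]
  rfl

variable [DecidableEq X]

/-- The maximal likelihood of a sequence over all distributions, attained by its type. -/
def maxLik (x : Fin n → X) : ℝ := lik (empDist x) x

lemma empDist_nonneg (x : Fin n → X) : 0 ≤ empDist x := fun a => by
  rw [Pi.zero_apply, empDist]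
  positivity

lemma support_empDist (x : Fin n → X) : support (empDist x) = Set.range x := by
  ext a
  rcases n.eq_zero_or_pos with rfl | hn
  · simp [empDist]
  · simp [empDist, hn.ne', Finset.filter_eq_empty_iff]

lemma empDist_apply_pos (x : Fin n → X) (k : Fin n) : 0 < empDist x (x k) :=
  (empDist_nonneg x _).lt_of_ne' (support_empDist x ▸ Set.mem_range_self k :)

lemma support_empDist_subset_of_lik_ne_zero {x : Fin n → X} {f : X → ℝ} (h : lik f x ≠ 0) :
    support (empDist x) ⊆ support f := by
  rw [support_empDist]
  rintro _ ⟨k, rfl⟩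
  exact Finset.prod_ne_zero_iff.1 h k (Finset.mem_univ k)

lemma maxLik_pos (x : Fin n → X) : 0 < maxLik x := by
  rw [maxLik, lik]
  exact Finset.prod_pos fun k _ => empDist_apply_pos x k

variable [Fintype X]

lemma sum_comp_eq_mul_sum_empDist (x : Fin n → X) (f : X → ℝ) :
    ∑ k, f (x k) = n * ∑ a, empDist x a * f a := by
  rcases n.eq_zero_or_pos with rfl | hn
  · simp
  simp only [empDist, Finset.mul_sum, Finset.sum_mul]
  rw [Finset.sum_comm]
  refine Finset.sum_congr rfl fun k _ => ?_
  simp [hn.ne']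

lemma empDist_mem_stdSimplex (hn : 0 < n) (x : Fin n → X) : empDist x ∈ stdSimplex ℝ X := by
  refine ⟨empDist_nonneg x, ?_⟩
  have h := sum_comp_eq_mul_sum_empDist x fun _ => 1
  simp only [Finset.sum_const, Finset.card_univ, Fintype.card_fin, nsmul_eq_mul, mul_one] at h
  exact (mul_eq_left₀ (by positivity)).1 h.symm

lemma lik_eq_exp_neg_mul_maxLik {x : Fin n → X} {f : X → ℝ} (hf : 0 ≤ f)
    (hxf : support (empDist x) ⊆ support f) :
    lik f x = Real.exp (-(n * kl (empDist x) f)) * maxLik x := by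
  rw [kl, ← sum_comp_eq_mul_sum_empDist x fun a => Real.log (empDist x a / f a),
    ← Finset.sum_neg_distrib, Real.exp_sum, maxLik, lik, lik, ← Finset.prod_mul_distrib]
  refine Finset.prod_congr rfl fun k _ => ?_
  have hx := empDist_apply_pos x k
  have hfx : 0 < f (x k) := (hf _).lt_of_ne' (hxf hx.ne')
  rw [← Real.log_inv, inv_div, Real.exp_log (div_pos hfx hx), div_mul_cancel₀ _ hx.ne']

lemma lik_le_sum_pow_mul_maxLik {f : X → ℝ} (hf : 0 ≤ f) (x : Fin n → X) :
    lik f x ≤ (∑ a, f a) ^ n * maxLik x := by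
  rcases eq_or_ne (lik f x) 0 with h0 | h0
  · rw [h0]
    exact mul_nonneg (pow_nonneg (Finset.sum_nonneg fun a _ => hf a) _) (maxLik_pos x).le
  rcases n.eq_zero_or_pos with rfl | hn
  · simp [lik, maxLik]
  have hxf := support_empDist_subset_of_lik_ne_zero h0
  rw [lik_eq_exp_neg_mul_maxLik hf hxf, ← mul_neg, Real.exp_nat_mul]
  have := (maxLik_pos x).le
  gcongr
  exact exp_neg_kl_le_sum (empDist_mem_stdSimplex hn x) hf hxf

lemma lik_rpow_mul_lik_rpow_le {η : ℝ} {f g : X → ℝ} (hf : 0 ≤ f) (hg : 0 ≤ g) (x : Fin n → X) :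
    lik f x ^ η * lik g x ^ (1 - η) ≤ bhat η f g ^ n * maxLik x := by
  rw [lik, lik, ← Real.finsetProd_rpow _ _ fun k _ => hf _,
    ← Real.finsetProd_rpow _ _ fun k _ => hg _, ← Finset.prod_mul_distrib]
  exact lik_le_sum_pow_mul_maxLik (f := fun a => f a ^ η * g a ^ (1 - η)) (fun a =>
    mul_nonneg (Real.rpow_nonneg (hf a) _) (Real.rpow_nonneg (hg a) _)) x

lemma lik_le_bhat_pow_mul_maxLik {η : ℝ} (hη : η ∈ Set.Icc 0 1) {P : X → ℝ}
    (hP : P ∈ stdSimplex ℝ X) (x : Fin n → X) :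
    lik P x ≤ bhat η (empDist x) P ^ n * maxLik x := by
  have hmax := (maxLik_pos x).le
  rcases eq_or_ne (lik P x) 0 with h0 | h0
  · rw [h0]
    exact mul_nonneg (pow_nonneg (bhat_nonneg (empDist_nonneg x) hP.1) _) hmax
  rcases n.eq_zero_or_pos with rfl | hn
  · simp [lik, maxLik]
  have hxP := support_empDist_subset_of_lik_ne_zero h0
  have hx := empDist_mem_stdSimplex hn x
  rw [lik_eq_exp_neg_mul_maxLik hP.1 hxP, ← mul_neg, Real.exp_nat_mul]
  gcongr
  refine le_trans (Real.exp_le_exp.2 ?_) (exp_neg_kl_le_bhat hx hP.1 hxP)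
  rw [neg_le_neg_iff]
  exact mul_le_of_le_one_left (kl_nonneg hx hP hxP) (sub_le_self 1 hη.1)

lemma card_image_empDist_le (n : ℕ) :
    (Finset.univ.image (empDist : (Fin n → X) → X → ℝ)).card ≤ (n + 1) ^ Fintype.card X := by
  have hsub : Finset.univ.image (empDist : (Fin n → X) → X → ℝ) ⊆
      Finset.univ.image fun (t : X → Fin (n + 1)) a => 1 / (n : ℝ) * (t a : ℕ) := by
    simp only [Finset.image_subset_iff, Finset.mem_image, Finset.mem_univ, true_and, forall_const]
    refine fun x => ⟨fun a => ⟨{k | x k = a}.toFinset.card,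
      Nat.lt_succ_of_le (card_finset_fin_le _)⟩, ?_⟩
    funext a
    simp [empDist]
  refine (Finset.card_le_card hsub).trans (Finset.card_image_le.trans ?_)
  simp

lemma sum_maxLik_le (n : ℕ) : ∑ x : Fin n → X, maxLik x ≤ ((n : ℝ) + 1) ^ Fintype.card X := by
  rcases n.eq_zero_or_pos with rfl | hn
  · simp [maxLik, lik]
  have hfiber : ∀ f ∈ Finset.univ.image (empDist : (Fin n → X) → X → ℝ),
      ∑ x : Fin n → X with empDist x = f, maxLik x ≤ 1 := by
    intro f hf
    obtain ⟨y, -, rfl⟩ := Finset.mem_image.1 hf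
    calc ∑ x with empDist x = empDist y, maxLik x
        = ∑ x : Fin n → X with empDist x = empDist y, lik (empDist y) x :=
          Finset.sum_congr rfl fun x hx => by rw [maxLik, (Finset.mem_filter.1 hx).2]
      _ ≤ ∑ x : Fin n → X, lik (empDist y) x :=
          Finset.sum_le_sum_of_subset_of_nonneg (Finset.filter_subset _ _)
            fun x _ _ => lik_nonneg (empDist_nonneg y) x
      _ = 1 := by rw [sum_lik, (empDist_mem_stdSimplex hn y).2, one_pow]
  rw [← Finset.sum_fiberwise_of_maps_to (g := empDist)
    fun x hx => Finset.mem_image_of_mem empDist hx]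
  refine (Finset.sum_le_card_nsmul _ _ 1 hfiber).trans ?_
  rw [nsmul_one]
  exact_mod_cast card_image_empDist_le n

lemma sum_lik_mul_lik_le {N k : ℕ} {b : ℝ} (hb : 0 ≤ b) {p q : X → ℝ}
    (s : Finset ((Fin N → X) × (Fin k → X)))
    (hs : ∀ z ∈ s, lik p z.1 * lik q z.2 ≤ b * (maxLik z.1 * maxLik z.2)) :
    ∑ z ∈ s, lik p z.1 * lik q z.2 ≤
      ((N : ℝ) + 1) ^ Fintype.card X * ((k : ℝ) + 1) ^ Fintype.card X * b := by
  calc ∑ z ∈ s, lik p z.1 * lik q z.2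
      ≤ ∑ z ∈ s, b * (maxLik z.1 * maxLik z.2) := Finset.sum_le_sum hs
    _ ≤ ∑ z : (Fin N → X) × (Fin k → X), b * (maxLik z.1 * maxLik z.2) :=
        Finset.sum_le_sum_of_subset_of_nonneg (Finset.subset_univ _) fun z _ _ =>
          mul_nonneg hb (mul_pos (maxLik_pos _) (maxLik_pos _)).le
    _ = (∑ x : Fin N → X, maxLik x) * (∑ y : Fin k → X, maxLik y) * b := by
        rw [← Finset.mul_sum, Fintype.sum_prod_type, Finset.sum_mul_sum, mul_comm]
    _ ≤ ((N : ℝ) + 1) ^ Fintype.card X * ((k : ℝ) + 1) ^ Fintype.card X * b := by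
        gcongr
        · exact Finset.sum_nonneg fun y _ => (maxLik_pos y).le
        · exact sum_maxLik_le N
        · exact sum_maxLik_le k

end Types

/-! ### The score as a likelihood ratio -/

section Score

variable {X : Type*} [Fintype X] [DecidableEq X] {N k : ℕ} {P Q : X → ℝ}

/-- The score `k GJS` of a training sequence and a finite test sequence; `score ω i k` is the case
of the `i`-th training sequence and the first `k` test samples. -/
def pairScore (x : Fin N → X) (y : Fin k → X) : ℝ :=
  k * gjs (empDist x) (empDist y) ((N : ℝ) / k)

lemma pairScore_eq_mul_gjs (hN : 0 < N) (hk : 0 < k) (x : Fin N → X) (y : Fin k → X) :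
    pairScore x y = N * gjs (empDist y) (empDist x) ((k : ℝ) / N) := by
  rw [pairScore, gjs_eq_mul_gjs_inv (by positivity), inv_div, ← mul_assoc,
    mul_div_cancel₀ _ (by positivity)]

lemma lik_mul_lik_eq_exp_neg {x : Fin N → X} {y : Fin k → X} {V : X → ℝ} (hV : 0 ≤ V)
    (hx : support (empDist x) ⊆ support V) (hy : support (empDist y) ⊆ support V) :
    lik V x * lik V y =
      Real.exp (-(N * kl (empDist x) V + k * kl (empDist y) V)) * (maxLik x * maxLik y) := by
  rw [lik_eq_exp_neg_mul_maxLik hV hx, lik_eq_exp_neg_mul_maxLik hV hy, neg_add, Real.exp_add]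
  ring

lemma lik_mix_mul_lik_mix (hN : 0 < N) (hk : 0 < k) (x : Fin N → X) (y : Fin k → X) :
    lik (mix (empDist x) (empDist y) (N / k)) x * lik (mix (empDist x) (empDist y) (N / k)) y =
      Real.exp (-pairScore x y) * (maxLik x * maxLik y) := by
  have hα : 0 < (N : ℝ) / k := by positivity
  have hx := empDist_mem_stdSimplex hN x
  have hy := empDist_mem_stdSimplex hk y
  rw [lik_mul_lik_eq_exp_neg (mix_mem_stdSimplex hx hy hα.le).1
    (support_subset_support_mix_left hx.1 hy.1 hα)
    (support_subset_support_mix_right hx.1 hy.1 hα.le), pairScore, gjs, mul_add,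
    ← mul_assoc (k : ℝ), mul_div_cancel₀ (N : ℝ) (by positivity)]

lemma lik_mul_lik_le_exp_neg_pairScore (hN : 0 < N) (hk : 0 < k) (hP : P ∈ stdSimplex ℝ X)
    (x : Fin N → X) (y : Fin k → X) :
    lik P x * lik P y ≤ Real.exp (-pairScore x y) * (maxLik x * maxLik y) := by
  have hM := mul_pos (maxLik_pos x) (maxLik_pos y)
  rcases eq_or_ne (lik P x * lik P y) 0 with h0 | h0
  · rw [h0]
    positivity
  have hxP := support_empDist_subset_of_lik_ne_zero (left_ne_zero_of_mul h0)
  have hyP := support_empDist_subset_of_lik_ne_zero (right_ne_zero_of_mul h0)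
  have hgjs := gjs_le (empDist_mem_stdSimplex hN x) (empDist_mem_stdSimplex hk y) hP
    (by positivity : 0 < (N : ℝ) / k) hxP hyP
  rw [lik_mul_lik_eq_exp_neg hP.1 hxP hyP, pairScore]
  gcongr
  calc k * gjs (empDist x) (empDist y) (N / k)
      ≤ k * (N / k * kl (empDist x) P + kl (empDist y) P) := by gcongr
    _ = N * kl (empDist x) P + k * kl (empDist y) P := by field_simp

-- The likelihood under `(P, Q)` is tilted towards the mixture of the two types, whose likelihood is
-- `exp (-pairScore x y)` times the maximal one.
lemma lik_mul_lik_rpow_le {η : ℝ} (hN : 0 < N) (hk : 0 < k) (hP : 0 ≤ P) (hQ : 0 ≤ Q)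
    (x : Fin N → X) (y : Fin k → X) :
    (lik P x * lik Q y) ^ η ≤ Real.exp ((1 - η) * pairScore x y) *
      (bhat η P (mix (empDist x) (empDist y) (N / k)) ^ N *
        bhat η Q (mix (empDist x) (empDist y) (N / k)) ^ k) * (maxLik x * maxLik y) ^ η := by
  have hW := (mix_mem_stdSimplex (empDist_mem_stdSimplex hN x) (empDist_mem_stdSimplex hk y)
    (by positivity : 0 ≤ (N : ℝ) / k)).1
  have hWW := lik_mix_mul_lik_mix hN hk x y
  set W := mix (empDist x) (empDist y) (N / k)
  set M := maxLik x * maxLik y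
  have hM : 0 < M := mul_pos (maxLik_pos x) (maxLik_pos y)
  have hPx := lik_nonneg hP x
  have hQy := lik_nonneg hQ y
  have hWx := lik_nonneg hW x
  have hWy := lik_nonneg hW y
  have htilt : (lik P x * lik Q y) ^ η * (lik W x * lik W y) ^ (1 - η) ≤
      bhat η P W ^ N * bhat η Q W ^ k * M := by
    calc (lik P x * lik Q y) ^ η * (lik W x * lik W y) ^ (1 - η)
        = (lik P x ^ η * lik W x ^ (1 - η)) * (lik Q y ^ η * lik W y ^ (1 - η)) := by
          rw [Real.mul_rpow hPx hQy, Real.mul_rpow hWx hWy]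
          ring
      _ ≤ (bhat η P W ^ N * maxLik x) * (bhat η Q W ^ k * maxLik y) :=
          mul_le_mul (lik_rpow_mul_lik_rpow_le hP hW x) (lik_rpow_mul_lik_rpow_le hQ hW y)
            (by positivity) (mul_nonneg (pow_nonneg (bhat_nonneg hP hW) _) (maxLik_pos x).le)
      _ = bhat η P W ^ N * bhat η Q W ^ k * M := by ring
  have hpow : (lik W x * lik W y) ^ (1 - η) =
      (Real.exp ((1 - η) * pairScore x y))⁻¹ * (M ^ η)⁻¹ * M := by
    rw [hWW, Real.mul_rpow (Real.exp_pos _).le hM.le, ← Real.exp_mul, ← Real.exp_neg,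
      Real.rpow_sub hM, Real.rpow_one, mul_assoc, ← div_eq_inv_mul]
    ring_nf
  rw [hpow, ← mul_assoc] at htilt
  have hdiv := le_of_mul_le_mul_right htilt hM
  rw [← mul_inv, ← div_eq_mul_inv, div_le_iff₀ (by positivity)] at hdiv
  exact hdiv.trans_eq (by ring)

lemma lik_mul_lik_le_exp_of_pairScore_le {γ s η : ℝ} {K : ℕ} (hN : 0 < N) (hk : 0 < k)
    (hη : η ∈ Set.Ioo 0 1) (hP : P ∈ stdSimplex ℝ X) (hQ : Q ∈ stdSimplex ℝ X) (hKN : K * N ≤ k)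
    (hK : ∀ V ∈ stdSimplex ℝ X,
      bhat η P V * bhat η Q V ^ K ≤ Real.exp (-(η * s + (1 - η) * γ)))
    {x : Fin N → X} {y : Fin k → X} (hxy : pairScore x y ≤ γ * N) :
    lik P x * lik Q y ≤ Real.exp (-(s * N)) * (maxLik x * maxLik y) := by
  have hW := mix_mem_stdSimplex (empDist_mem_stdSimplex hN x) (empDist_mem_stdSimplex hk y)
    (by positivity : 0 ≤ (N : ℝ) / k)
  have hbhat := bhat_pow_mul_bhat_pow_le (Set.Ioo_subset_Icc_self hη) hP.1 hQ hW hKN (hK _ hW)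
  have hM := mul_pos (maxLik_pos x) (maxLik_pos y)
  have hη' := sub_pos.2 hη.2
  refine (Real.rpow_le_rpow_iff (mul_nonneg (lik_nonneg hP.1 x) (lik_nonneg hQ.1 y))
    (by positivity) hη.1).1 ?_
  calc (lik P x * lik Q y) ^ η
      ≤ _ := lik_mul_lik_rpow_le hN hk hP.1 hQ.1 x y
    _ ≤ Real.exp ((1 - η) * (γ * N)) * Real.exp (-(η * s + (1 - η) * γ)) ^ N *
          (maxLik x * maxLik y) ^ η := by
        have hPW := bhat_nonneg (η := η) hP.1 hW.1
        have hQW := bhat_nonneg (η := η) hQ.1 hW.1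
        gcongr
    _ = (Real.exp (-(s * N)) * (maxLik x * maxLik y)) ^ η := by
        rw [Real.mul_rpow (Real.exp_pos _).le hM.le, ← Real.exp_mul, ← Real.exp_nat_mul,
          ← Real.exp_add]
        ring_nf

lemma lik_mul_lik_le_pow_of_pairScore_le {γ c r η : ℝ} (hN : 0 < N) (hη : η ∈ Set.Icc 0 1)
    (hc : 0 < c) (hP : P ∈ stdSimplex ℝ X) (hQ : Q ∈ stdSimplex ℝ X) (hck : c * N ≤ k)
    (hr : ∀ q ∈ stdSimplex ℝ X, ∀ p ∈ stdSimplex ℝ X, gjs q p c ≤ γ →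
      bhat η q Q ^ c * bhat η p P ≤ r)
    {x : Fin N → X} {y : Fin k → X} (hxy : pairScore x y ≤ γ * N) :
    lik P x * lik Q y ≤ r ^ N * (maxLik x * maxLik y) := by
  have hN' : (0 : ℝ) < N := by positivity
  have hk : 0 < k := by exact_mod_cast (mul_pos hc hN').trans_le hck
  have hx := empDist_mem_stdSimplex hN x
  have hy := empDist_mem_stdSimplex hk y
  have hgjs : gjs (empDist y) (empDist x) c ≤ γ := by
    rw [pairScore_eq_mul_gjs hN hk, mul_comm γ, mul_le_mul_iff_right₀ hN'] at hxy
    exact (monotoneOn_gjs hy hx hc (by positivity : 0 < (k : ℝ) / N)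
      ((le_div_iff₀ hN').2 hck)).trans hxy
  have hM := mul_pos (maxLik_pos x) (maxLik_pos y)
  have hPx := bhat_nonneg (η := η) hx.1 hP.1
  have hQy := bhat_nonneg (η := η) hy.1 hQ.1
  have hpow : bhat η (empDist y) Q ^ k ≤ (bhat η (empDist y) Q ^ c) ^ N := by
    rw [← Real.rpow_natCast _ N, ← Real.rpow_mul hQy, ← Real.rpow_natCast]
    exact Real.rpow_le_rpow_of_exponent_ge_of_imp hQy (bhat_le_one hη hy hQ) hck
      fun _ h => absurd h (by positivity)
  calc lik P x * lik Q y
      ≤ (bhat η (empDist x) P ^ N * maxLik x) * (bhat η (empDist y) Q ^ k * maxLik y) :=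
        mul_le_mul (lik_le_bhat_pow_mul_maxLik hη hP x) (lik_le_bhat_pow_mul_maxLik hη hQ y)
          (lik_nonneg hQ.1 y) (mul_nonneg (pow_nonneg hPx _) (maxLik_pos x).le)
    _ = (bhat η (empDist x) P ^ N * bhat η (empDist y) Q ^ k) * (maxLik x * maxLik y) := by ring
    _ ≤ (bhat η (empDist x) P ^ N * (bhat η (empDist y) Q ^ c) ^ N) *
          (maxLik x * maxLik y) := by gcongr
    _ = (bhat η (empDist y) Q ^ c * bhat η (empDist x) P) ^ N * (maxLik x * maxLik y) := by
        rw [← mul_pow, mul_comm (bhat η (empDist x) P)]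
    _ ≤ r ^ N * (maxLik x * maxLik y) := by
        gcongr
        exact hr _ hy _ hx hgjs

end Score

/-! ### Chernoff information -/

section Chernoff

lemma ofReal_mass {X : Type*} (P : PMF X) (a : X) : ENNReal.ofReal (mass P a) = P a :=
  ENNReal.ofReal_toReal (P.apply_ne_top a)

lemma support_mass {X : Type*} (P : PMF X) : support (mass P) = P.support := by
  ext a
  simp [mass, ENNReal.toReal_eq_zero_iff, P.apply_ne_top]

lemma mass_nonneg {X : Type*} (P : PMF X) : 0 ≤ mass P := fun _ => ENNReal.toReal_nonneg

variable {X : Type*} [Fintype X] {P Q : PMF X} {γ : ℝ}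

lemma mass_mem_stdSimplex (P : PMF X) : mass P ∈ stdSimplex ℝ X := by
  refine ⟨mass_nonneg P, ?_⟩
  simp only [mass]
  rw [← ENNReal.toReal_sum fun a _ => P.apply_ne_top a, ← tsum_fintype (L := .unconditional _),
    P.tsum_coe, ENNReal.toReal_one]

lemma sum_rpow_mul_rpow_eq_ofReal_bhat (P Q : PMF X) {η : ℝ} (hη : η ∈ Set.Icc 0 1) :
    ∑ x, P x ^ η * Q x ^ (1 - η) = ENNReal.ofReal (bhat η (mass P) (mass Q)) := by
  have hP := mass_nonneg P
  have hQ := mass_nonneg Q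
  rw [bhat, ENNReal.ofReal_sum_of_nonneg fun a _ =>
    mul_nonneg (Real.rpow_nonneg (hP a) _) (Real.rpow_nonneg (hQ a) _)]
  refine Finset.sum_congr rfl fun a _ => ?_
  rw [ENNReal.ofReal_mul (Real.rpow_nonneg (hP a) _),
    ← ENNReal.ofReal_rpow_of_nonneg (hP a) hη.1,
    ← ENNReal.ofReal_rpow_of_nonneg (hQ a) (sub_nonneg.2 hη.2), ofReal_mass, ofReal_mass]

lemma chernoff_eq_neg_iInf_log_bhat (P Q : PMF X) : chernoff P Q =
    -⨅ η : Set.Icc (0 : ℝ) 1, ENNReal.log (ENNReal.ofReal (bhat η (mass P) (mass Q))) := by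
  simp only [chernoff, sum_rpow_mul_rpow_eq_ofReal_bhat P Q (Subtype.prop _)]

lemma log_ofReal_le_coe_iff {r t : ℝ} :
    ENNReal.log (ENNReal.ofReal r) ≤ (t : EReal) ↔ r ≤ Real.exp t := by
  rw [← Real.log_exp t, ← ENNReal.log_ofReal_of_pos (Real.exp_pos t), ENNReal.log_le_log_iff,
    ENNReal.ofReal_le_ofReal_iff (Real.exp_pos t).le, Real.log_exp]

lemma continuousOn_bhat_of_support_eq {p q : X → ℝ} (h : support p = support q) :
    ContinuousOn (fun η => bhat η p q) (Set.Icc 0 1) := by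
  refine continuousOn_finsetSum _ fun a _ => ?_
  have ha : p a = 0 ↔ q a = 0 := not_iff_not.1 (Set.ext_iff.1 h a)
  by_cases hp : p a = 0
  -- At the endpoints one of the factors of `0 ^ η * 0 ^ (1 - η)` is `0 ^ 0 = 1`, but not both.
  · refine (continuousOn_const (c := (0 : ℝ))).congr fun η _ => ?_
    rcases eq_or_ne η 0 with rfl | hη
    · simp [ha.1 hp]
    · simp [hp, hη]
  · exact ((Real.continuous_const_rpow hp).mul
      ((Real.continuous_const_rpow (mt ha.2 hp)).comp (by fun_prop))).continuousOn

lemma exists_bhat_le_of_lt_chernoff (h : (γ : EReal) < chernoff P Q) :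
    ∃ η ∈ Set.Icc (0 : ℝ) 1, bhat η (mass P) (mass Q) ≤ Real.exp (-γ) := by
  rw [chernoff_eq_neg_iInf_log_bhat, EReal.lt_neg_comm, iInf_lt_iff] at h
  obtain ⟨η, hη⟩ := h
  exact ⟨η, η.2, log_ofReal_le_coe_iff.1 (by exact_mod_cast hη.le)⟩

lemma exists_bhat_le_of_eq_chernoff (h : (γ : EReal) = chernoff P Q)
    (hs : P.support = Q.support) :
    ∃ η ∈ Set.Icc (0 : ℝ) 1, bhat η (mass P) (mass Q) ≤ Real.exp (-γ) := by
  obtain ⟨η, hη, hmin⟩ := isCompact_Icc.exists_isMinOn (Set.nonempty_Icc.2 zero_le_one)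
    (continuousOn_bhat_of_support_eq (p := mass P) (q := mass Q) (by simpa only [support_mass]))
  refine ⟨η, hη, log_ofReal_le_coe_iff.1 ?_⟩
  rw [EReal.coe_neg, h, chernoff_eq_neg_iInf_log_bhat, neg_neg]
  exact le_iInf fun η' => ENNReal.log_le_log (ENNReal.ofReal_le_ofReal (hmin η'.2))

lemma chernoffSeparated_of_le_chernoff (h : (γ : EReal) ≤ chernoff P Q)
    (hs : (γ : EReal) = chernoff P Q → P.support = Q.support) :
    ChernoffSeparated γ (mass P) (mass Q) := by
  have hP := mass_mem_stdSimplex P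
  have hQ := mass_mem_stdSimplex Q
  rcases le_or_gt γ 0 with hγ | hγ
  · have hη : (1 / 2 : ℝ) ∈ Set.Ioo 0 1 := by norm_num
    exact ⟨1 / 2, hη, (bhat_le_one (Set.Ioo_subset_Icc_self hη) hP hQ).trans
      (Real.one_le_exp (by linarith))⟩
  obtain ⟨η, hη, hb⟩ := h.lt_or_eq.elim exists_bhat_le_of_lt_chernoff
    fun heq => exists_bhat_le_of_eq_chernoff heq (hs heq)
  have hlt : bhat η (mass P) (mass Q) < 1 := hb.trans_lt (Real.exp_lt_one_iff.2 (by linarith))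
  refine ⟨η, ⟨hη.1.lt_of_ne' ?_, hη.2.lt_of_ne ?_⟩, hb⟩
  · rintro rfl
    simp [bhat, hQ.2] at hlt
  · rintro rfl
    simp [bhat, hP.2] at hlt

end Chernoff

/-! ### Events that depend on one training sequence and finitely many test samples -/

section Law

lemma measurePreserving_prefix {Y : Type*} [MeasurableSpace Y] (μ : Measure Y)
    [IsProbabilityMeasure μ] (k : ℕ) :
    MeasurePreserving (fun (y : ℕ → Y) (m : Fin k) => y m) (Measure.infinitePi fun _ => μ)
      (Measure.pi fun _ => μ) :=
  ⟨by fun_prop, (Measure.map_infinitePi_infinitePi_of_inj Fin.val_injective).trans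
    (Measure.infinitePi_eq_pi _)⟩

variable {X : Type*} [MeasurableSpace X] {M N k : ℕ}

lemma measurePreserving_train_prefix (P : Fin M → PMF X) (N k : ℕ) (i j : Fin M) :
    MeasurePreserving (fun ω : Obs X M N => (ω.1 j, fun m : Fin k => ω.2 m)) (law P N i)
      ((Measure.pi fun _ => (P j).toMeasure).prod (Measure.pi fun _ => (P i).toMeasure)) :=
  (measurePreserving_eval (fun j => Measure.pi fun _ : Fin N => (P j).toMeasure) j).prod
    (measurePreserving_prefix (P i).toMeasure k)

instance isProbabilityMeasure_law (P : Fin M → PMF X) (N : ℕ) (i : Fin M) :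
    IsProbabilityMeasure (law P N i) := by
  unfold law
  infer_instance

variable [DiscreteMeasurableSpace X]

lemma pi_toMeasure_singleton (P : PMF X) (x : Fin N → X) :
    (Measure.pi fun _ => P.toMeasure) {x} = ENNReal.ofReal (lik (mass P) x) := by
  rw [Measure.pi_singleton, lik,
    ENNReal.ofReal_prod_of_nonneg fun k _ => mass_nonneg P _]
  refine Finset.prod_congr rfl fun k _ => ?_
  rw [PMF.toMeasure_apply_singleton _ _ (measurableSet_singleton _), ofReal_mass]

lemma pi_prod_pi_toMeasure_singleton (P Q : PMF X) (x : Fin N → X) (y : Fin k → X) :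
    ((Measure.pi fun _ => P.toMeasure).prod (Measure.pi fun _ => Q.toMeasure)) {(x, y)} =
      ENNReal.ofReal (lik (mass P) x * lik (mass Q) y) := by
  rw [← Set.singleton_prod_singleton, Measure.prod_prod, pi_toMeasure_singleton,
    pi_toMeasure_singleton, ← ENNReal.ofReal_mul (lik_nonneg (mass_nonneg P) _)]

variable [Fintype X] [DecidableEq X]

lemma law_le_of_lik_mul_lik_le (P : Fin M → PMF X) (i j : Fin M) {b : ℝ} (hb : 0 ≤ b)
    {E : Set ((Fin N → X) × (Fin k → X))} (hE : ∀ z ∈ E,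
      lik (mass (P j)) z.1 * lik (mass (P i)) z.2 ≤ b * (maxLik z.1 * maxLik z.2)) :
    law P N i {ω | (ω.1 j, fun m : Fin k => ω.2 m) ∈ E} ≤ ENNReal.ofReal
      (((N : ℝ) + 1) ^ Fintype.card X * ((k : ℝ) + 1) ^ Fintype.card X * b) := by
  classical
  have hlik : ∀ z : (Fin N → X) × (Fin k → X),
      0 ≤ lik (mass (P j)) z.1 * lik (mass (P i)) z.2 := fun z =>
    mul_nonneg (lik_nonneg (mass_nonneg _) _) (lik_nonneg (mass_nonneg _) _)
  calc law P N i {ω | (ω.1 j, fun m : Fin k => ω.2 m) ∈ E}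
      = ((Measure.pi fun _ => (P j).toMeasure).prod (Measure.pi fun _ => (P i).toMeasure)) E :=
        (measurePreserving_train_prefix P N k i j).measure_preimage
          E.toFinite.measurableSet.nullMeasurableSet
    _ = ENNReal.ofReal (∑ z ∈ E.toFinset, lik (mass (P j)) z.1 * lik (mass (P i)) z.2) := by
        rw [ENNReal.ofReal_sum_of_nonneg fun z _ => hlik z, ← Set.coe_toFinset E,
          ← sum_measure_singleton, Finset.toFinset_coe]
        exact Finset.sum_congr rfl fun z _ => pi_prod_pi_toMeasure_singleton _ _ _ _
    _ ≤ _ := ENNReal.ofReal_le_ofReal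
        (sum_lik_mul_lik_le hb E.toFinset fun z hz => hE z (Set.mem_toFinset.1 hz))

lemma law_le_of_lik_mul_lik_le_of_le_sq (P : Fin M → PMF X) (i j : Fin M) {b : ℝ} (hb : 0 ≤ b)
    (hk : k ≤ N ^ 2) {E : Set ((Fin N → X) × (Fin k → X))} (hE : ∀ z ∈ E,
      lik (mass (P j)) z.1 * lik (mass (P i)) z.2 ≤ b * (maxLik z.1 * maxLik z.2)) :
    law P N i {ω | (ω.1 j, fun m : Fin k => ω.2 m) ∈ E} ≤
      ENNReal.ofReal (((N : ℝ) + 1) ^ (3 * Fintype.card X) * b) := by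
  refine (law_le_of_lik_mul_lik_le P i j hb hE).trans (ENNReal.ofReal_le_ofReal ?_)
  have hkN : (k : ℝ) + 1 ≤ ((N : ℝ) + 1) ^ 2 := by
    have : (k : ℝ) ≤ (N : ℝ) ^ 2 := by exact_mod_cast hk
    nlinarith [Nat.cast_nonneg (α := ℝ) N]
  calc ((N : ℝ) + 1) ^ Fintype.card X * ((k : ℝ) + 1) ^ Fintype.card X * b
      ≤ ((N : ℝ) + 1) ^ Fintype.card X * (((N : ℝ) + 1) ^ 2) ^ Fintype.card X * b := by gcongr
    _ = ((N : ℝ) + 1) ^ (3 * Fintype.card X) * b := by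
        rw [← pow_mul, ← pow_add]
        ring_nf

end Law

/-! ### Pathwise properties of the test -/

section Test

variable {X : Type*} [Fintype X] [DecidableEq X] {M N n : ℕ} {γ : ℝ} {ω : Obs X M N} {i j : Fin M}

lemma ncard_lt_pred_of_notMem {s : Set (Fin M)} (hij : i ≠ j) (hi : i ∉ s) (hj : j ∉ s) :
    s.ncard < M - 1 := by
  have hpair : 2 ≤ sᶜ.ncard := by
    rw [← Set.ncard_pair hij]
    exact Set.ncard_le_ncard (Set.insert_subset hi (Set.singleton_subset_iff.2 hj))
  have hsum := Set.ncard_add_ncard_compl s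
  rw [Nat.card_eq_fintype_card, Fintype.card_fin] at hsum
  omega

lemma stopTime_le : stopTime γ ω ≤ N ^ 2 := Nat.sInf_le (Set.mem_insert _ _)

lemma stopTime_mem : stopTime γ ω ∈
    insert (N ^ 2) {n : ℕ | 1 ≤ n ∧ M - 1 ≤ (Psi γ ω n).ncard} :=
  Nat.sInf_mem (Set.insert_nonempty _ _)

lemma one_le_stopTime (hN : 0 < N) : 1 ≤ stopTime γ ω := by
  rcases stopTime_mem (γ := γ) (ω := ω) with h | h
  · exact (Nat.pow_pos hN).trans_eq h.symm
  · exact h.1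

lemma score_lt_of_notMem_Psi (hn : 1 ≤ n) (h : j ∉ Psi γ ω n) : score ω j n < γ * N :=
  not_le.1 fun hle => h ⟨n, hn, le_rfl, hle⟩

lemma exists_score_lt_of_lt_stopTime (i : Fin M) (hn : 1 ≤ n) (h : n < stopTime γ ω) :
    ∃ j ≠ i, score ω j n < γ * N := by
  by_contra! hall
  have hsub : {i}ᶜ ⊆ Psi γ ω n := fun j hj => ⟨n, hn, le_rfl, hall j hj⟩
  have hcard := Set.ncard_le_ncard hsub
  rw [Set.ncard_compl, Set.ncard_singleton, Nat.card_eq_fintype_card, Fintype.card_fin] at hcard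
  exact h.not_ge (Nat.sInf_le (Set.mem_insert_of_mem _ ⟨hn, hcard⟩))

-- If the true class `i` never enters `Ψ` and the decision is still wrong, then `Ψ` misses two
-- classes, so the test has only been stopped by the deadline `N ^ 2`.
lemma exists_of_decision_ne (hN : 0 < N) (h : decision γ ω ≠ {i}) :
    (∃ k ∈ Finset.Icc 1 (N ^ 2), γ * N ≤ score ω i k) ∨
      ∃ j ≠ i, score ω j (N ^ 2) < γ * N := by
  by_cases hi : i ∈ Psi γ ω (stopTime γ ω)
  · obtain ⟨k, hk1, hk2, hk⟩ := hi
    exact Or.inl ⟨k, Finset.mem_Icc.2 ⟨hk1, hk2.trans stopTime_le⟩, hk⟩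
  obtain ⟨j, hj, hji⟩ : ∃ j ∈ decision γ ω, j ≠ i := by
    by_contra! hall
    exact h (Set.eq_singleton_iff_unique_mem.2 ⟨hi, hall⟩)
  have hcard := ncard_lt_pred_of_notMem hji hj hi
  have hT : stopTime γ ω = N ^ 2 := stopTime_mem.resolve_right fun hmem => hcard.not_ge hmem.2
  refine Or.inr ⟨j, hji, score_lt_of_notMem_Psi (γ := γ) (Nat.pow_pos hN) ?_⟩
  rwa [← hT]

end Test

/-! ### Error probability and expected stopping time for long training sequences -/

section Asymptotics

lemma tendsto_add_one_pow_mul_pow {r : ℝ} (D : ℕ) (hr0 : 0 ≤ r) (hr1 : r < 1) :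
    Tendsto (fun N : ℕ => ((N : ℝ) + 1) ^ D * r ^ N) atTop (𝓝 0) := by
  have hlim := (tendsto_pow_const_mul_const_pow_of_lt_one D hr0 hr1).const_mul ((2 : ℝ) ^ D)
  rw [mul_zero] at hlim
  refine squeeze_zero' (Eventually.of_forall fun N => by positivity) ?_ hlim
  filter_upwards [eventually_ge_atTop 1] with N hN
  have hN1 : (1 : ℝ) ≤ N := by exact_mod_cast hN
  rw [← mul_assoc, ← mul_pow]
  gcongr
  linarith

variable {X : Type*} [Fintype X] [DecidableEq X] [MeasurableSpace X] {M N k : ℕ}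
  {P : Fin M → PMF X} {γ s c : ℝ} {i j : Fin M}

lemma errProb_le_sum (hN : 0 < N) :
    errProb P γ i N ≤ ∑ k ∈ Finset.Icc 1 (N ^ 2), law P N i {ω | γ * N ≤ score ω i k} +
      ∑ j ∈ Finset.univ.erase i, law P N i {ω | score ω j (N ^ 2) < γ * N} := by
  have hsub : {ω : Obs X M N | decision γ ω ≠ {i}} ⊆
      (⋃ k ∈ Finset.Icc 1 (N ^ 2), {ω | γ * N ≤ score ω i k}) ∪
        ⋃ j ∈ Finset.univ.erase i, {ω | score ω j (N ^ 2) < γ * N} := by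
    intro ω hω
    simpa only [Set.mem_union, Set.mem_iUnion, Set.mem_ofPred_eq, Finset.mem_erase,
      Finset.mem_univ, and_true, exists_prop] using exists_of_decision_ne hN hω
  exact (measure_mono hsub).trans ((measure_union_le _ _).trans
    (add_le_add (measure_biUnion_finset_le _ _) (measure_biUnion_finset_le _ _)))

lemma errProb_le_nsmul (hN : 0 < N) {β : ENNReal}
    (hhigh : ∀ k ∈ Finset.Icc 1 (N ^ 2), law P N i {ω | γ * N ≤ score ω i k} ≤ β)
    (hlow : ∀ j ≠ i, law P N i {ω | score ω j (N ^ 2) < γ * N} ≤ β) :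
    errProb P γ i N ≤ (N ^ 2 + M) • β := by
  rw [add_nsmul]
  refine (errProb_le_sum hN).trans (add_le_add ?_ ?_)
  · simpa using Finset.sum_le_card_nsmul _ _ _ hhigh
  · refine (Finset.sum_le_card_nsmul _ _ _ fun j hj => hlow j (Finset.ne_of_mem_erase hj)).trans
      (nsmul_le_nsmul_left bot_le ?_)
    simp

lemma expTime_le_sum (hk : 1 ≤ k) :
    expTime P γ i N ≤
      k + ∑ j ∈ Finset.univ.erase i, (N : ENNReal) ^ 2 * law P N i {ω | score ω j k < γ * N} := by
  set S : Set (Obs X M N) := ⋃ j ∈ Finset.univ.erase i, {ω | score ω j k < γ * N} with hS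
  have hle : ∀ ω : Obs X M N,
      (stopTime γ ω : ENNReal) ≤ k + S.indicator (fun _ => (N : ENNReal) ^ 2) ω := by
    intro ω
    rcases le_or_gt (stopTime γ ω) k with h | h
    · exact le_add_right (by exact_mod_cast h)
    · have hω : ω ∈ S := by
        simpa only [hS, Set.mem_iUnion, Set.mem_ofPred_eq, Finset.mem_erase, Finset.mem_univ,
          and_true, exists_prop] using exists_score_lt_of_lt_stopTime i hk h
      rw [Set.indicator_of_mem hω]
      exact le_add_left (by exact_mod_cast stopTime_le)
  calc expTime P γ i N ≤ ∫⁻ ω, (k + S.indicator (fun _ => (N : ENNReal) ^ 2) ω) ∂(law P N i) :=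
        lintegral_mono hle
    _ = k + ∫⁻ ω, S.indicator (fun _ => (N : ENNReal) ^ 2) ω ∂(law P N i) := by
        rw [lintegral_add_left measurable_const, lintegral_const, measure_univ, mul_one]
    _ ≤ k + (N : ENNReal) ^ 2 * ∑ j ∈ Finset.univ.erase i,
          law P N i {ω | score ω j k < γ * N} := by
        gcongr
        exact (lintegral_indicator_const_le _ _).trans
          (mul_le_mul_right (measure_biUnion_finset_le _ _) _)
    _ = _ := by rw [Finset.mul_sum]

lemma one_le_expTime (hN : 0 < N) : 1 ≤ expTime P γ i N := by
  calc (1 : ENNReal) = ∫⁻ _, 1 ∂(law P N i) := by rw [lintegral_one, measure_univ]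
    _ ≤ expTime P γ i N := lintegral_mono fun ω => Nat.one_le_cast.2 (one_le_stopTime hN)

variable [DiscreteMeasurableSpace X]

lemma law_threshold_le_score_le (hN : 0 < N) (hk : k ∈ Finset.Icc 1 (N ^ 2)) :
    law P N i {ω | γ * N ≤ score ω i k} ≤
      ENNReal.ofReal (((N : ℝ) + 1) ^ (3 * Fintype.card X) * Real.exp (-(γ * N))) := by
  obtain ⟨hk1, hk2⟩ := Finset.mem_Icc.1 hk
  refine law_le_of_lik_mul_lik_le_of_le_sq (E := {z | γ * N ≤ pairScore z.1 z.2}) P i i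
    (Real.exp_pos _).le hk2 fun z hz => ?_
  have hM := mul_pos (maxLik_pos z.1) (maxLik_pos z.2)
  refine (lik_mul_lik_le_exp_neg_pairScore hN hk1 (mass_mem_stdSimplex _) z.1 z.2).trans ?_
  gcongr
  exact hz

lemma eventually_law_score_lt_le (h : ChernoffSeparated γ (mass (P j)) (mass (P i)))
    (hs : s < γ) :
    ∀ᶠ N : ℕ in atTop, law P N i {ω | score ω j (N ^ 2) < γ * N} ≤
      ENNReal.ofReal (((N : ℝ) + 1) ^ (3 * Fintype.card X) * Real.exp (-(s * N))) := by
  obtain ⟨η, hη, hb⟩ := h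
  have hlt : bhat η (mass (P j)) (mass (P i)) < Real.exp (-(η * s + (1 - η) * γ)) :=
    hb.trans_lt (Real.exp_lt_exp.2 (by nlinarith [hη.1]))
  obtain ⟨K, hK⟩ := exists_bhat_mul_bhat_pow_le hη (mass_mem_stdSimplex _) (mass_mem_stdSimplex _)
    (Real.exp_pos _) hlt
  filter_upwards [eventually_gt_atTop 0, eventually_ge_atTop K] with N hN hKN
  refine law_le_of_lik_mul_lik_le_of_le_sq (E := {z | pairScore z.1 z.2 < γ * N}) P i j
    (Real.exp_pos _).le le_rfl fun z hz => ?_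
  exact lik_mul_lik_le_exp_of_pairScore_le hN (Nat.pow_pos hN) hη (mass_mem_stdSimplex _)
    (mass_mem_stdSimplex _) (by rw [sq]; exact Nat.mul_le_mul_right N hKN) hK (le_of_lt hz)

lemma eventually_errProb_le (h : ∀ j ≠ i, ChernoffSeparated γ (mass (P j)) (mass (P i)))
    (hs : s < γ) :
    ∀ᶠ N : ℕ in atTop, errProb P γ i N ≤ ENNReal.ofReal (Real.exp (-(s * N))) := by
  obtain ⟨s', hss', hs'⟩ := exists_between hs
  set d := 3 * Fintype.card X with hd
  have hlow : ∀ᶠ N : ℕ in atTop, ∀ j ≠ i, law P N i {ω | score ω j (N ^ 2) < γ * N} ≤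
      ENNReal.ofReal (((N : ℝ) + 1) ^ d * Real.exp (-(s' * N))) :=
    eventually_all.2 fun j => eventually_imp_distrib_left.2 fun hj =>
      eventually_law_score_lt_le (h j hj) hs'
  have hpoly := (tendsto_add_one_pow_mul_pow (d + 2) (Real.exp_pos (s - s')).le
    (Real.exp_lt_one_iff.2 (by linarith))).const_mul ((M : ℝ) + 1)
  rw [mul_zero] at hpoly
  filter_upwards [hlow, hpoly.eventually_le_const one_pos, eventually_gt_atTop 0]
    with N hlow hpoly hN
  have hhigh : ∀ k ∈ Finset.Icc 1 (N ^ 2), law P N i {ω | γ * N ≤ score ω i k} ≤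
      ENNReal.ofReal (((N : ℝ) + 1) ^ d * Real.exp (-(s' * N))) := fun k hk =>
    (law_threshold_le_score_le hN hk).trans (ENNReal.ofReal_le_ofReal (by rw [hd]; gcongr))
  refine (errProb_le_nsmul hN hhigh hlow).trans ?_
  rw [← ENNReal.ofReal_nsmul, nsmul_eq_mul]
  refine ENNReal.ofReal_le_ofReal ?_
  have hcount : ((N ^ 2 + M : ℕ) : ℝ) ≤ (M + 1) * ((N : ℝ) + 1) ^ 2 := by
    push_cast
    nlinarith [Nat.cast_nonneg (α := ℝ) N, mul_nonneg (Nat.cast_nonneg (α := ℝ) M)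
      (by positivity : (0 : ℝ) ≤ (N : ℝ) ^ 2 + 2 * N)]
  have hexp : Real.exp (-(s' * N)) = Real.exp (s - s') ^ N * Real.exp (-(s * N)) := by
    rw [← Real.exp_nat_mul, ← Real.exp_add]
    ring_nf
  calc ((N ^ 2 + M : ℕ) : ℝ) * (((N : ℝ) + 1) ^ d * Real.exp (-(s' * N)))
      ≤ (M + 1) * ((N : ℝ) + 1) ^ 2 * (((N : ℝ) + 1) ^ d * Real.exp (-(s' * N))) := by gcongr
    _ = (M + 1) * (((N : ℝ) + 1) ^ (d + 2) * Real.exp (s - s') ^ N) * Real.exp (-(s * N)) := by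
        rw [hexp]
        ring
    _ ≤ Real.exp (-(s * N)) := mul_le_of_le_one_left (Real.exp_pos _).le hpoly

lemma tendsto_sq_mul_law_score_lt (hc : 0 < c) (h : γ < gjs (mass (P i)) (mass (P j)) c) :
    Tendsto (fun N : ℕ => (N : ENNReal) ^ 2 * law P N i {ω | score ω j ⌈c * N⌉₊ < γ * N}) atTop
      (𝓝 0) := by
  have hη : (1 / 2 : ℝ) ∈ Set.Ioo 0 1 := by norm_num
  obtain ⟨r, ⟨hr0, hr1⟩, hr⟩ := exists_bhat_rpow_mul_bhat_le_of_lt_gjs hη hc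
    (mass_mem_stdSimplex (P i)) (mass_mem_stdSimplex (P j)) h
  have hlim := ENNReal.tendsto_ofReal
    (tendsto_add_one_pow_mul_pow (3 * Fintype.card X + 2) hr0 hr1)
  rw [ENNReal.ofReal_zero] at hlim
  refine tendsto_of_tendsto_of_tendsto_of_le_of_le' tendsto_const_nhds hlim
    (Eventually.of_forall fun _ => bot_le) ?_
  filter_upwards [eventually_gt_atTop 0, eventually_ge_atTop ⌈c⌉₊] with N hN hcN
  have hk : ⌈c * N⌉₊ ≤ N ^ 2 := by
    rw [Nat.ceil_le, Nat.cast_pow, sq]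
    gcongr
    exact Nat.ceil_le.1 hcN
  have hlaw := law_le_of_lik_mul_lik_le_of_le_sq (E := {z | pairScore z.1 z.2 < γ * N}) P i j
    (by positivity : 0 ≤ r ^ N) hk fun z hz => lik_mul_lik_le_pow_of_pairScore_le hN
      (Set.Ioo_subset_Icc_self hη) hc (mass_mem_stdSimplex _) (mass_mem_stdSimplex _)
      (Nat.le_ceil _) hr (le_of_lt hz)
  calc (N : ENNReal) ^ 2 * law P N i {ω | score ω j ⌈c * N⌉₊ < γ * N}
      ≤ (N : ENNReal) ^ 2 *
          ENNReal.ofReal (((N : ℝ) + 1) ^ (3 * Fintype.card X) * r ^ N) := by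
        gcongr
        exact hlaw
    _ = ENNReal.ofReal ((N : ℝ) ^ 2 * (((N : ℝ) + 1) ^ (3 * Fintype.card X) * r ^ N)) := by
        rw [ENNReal.ofReal_mul (by positivity : 0 ≤ (N : ℝ) ^ 2),
          ENNReal.ofReal_pow (Nat.cast_nonneg N),
          ENNReal.ofReal_natCast]
    _ ≤ ENNReal.ofReal (((N : ℝ) + 1) ^ (3 * Fintype.card X + 2) * r ^ N) := by
        refine ENNReal.ofReal_le_ofReal ?_
        rw [pow_add, mul_assoc, mul_left_comm]
        gcongr
        linarith

lemma eventually_expTime_le (hc : 0 < c)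
    (h : ∀ j ≠ i, γ < gjs (mass (P i)) (mass (P j)) c) :
    ∀ᶠ N : ℕ in atTop, expTime P γ i N ≤ ENNReal.ofReal (c * N + 2) := by
  have hlim := tendsto_finsetSum (Finset.univ.erase i) fun j hj =>
    tendsto_sq_mul_law_score_lt hc (h j (Finset.ne_of_mem_erase hj))
  rw [Finset.sum_const_zero] at hlim
  filter_upwards [hlim.eventually_le_const one_pos, eventually_gt_atTop 0] with N hsum hN
  have hcN : 0 < c * N := by positivity
  calc expTime P γ i N ≤ ⌈c * N⌉₊ + 1 :=
        (expTime_le_sum (Nat.ceil_pos.2 hcN)).trans (by gcongr)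
    _ = ENNReal.ofReal (⌈c * N⌉₊ + 1) := by
        rw [ENNReal.ofReal_add (by positivity) one_pos.le, ENNReal.ofReal_natCast,
          ENNReal.ofReal_one]
    _ ≤ ENNReal.ofReal (c * N + 2) :=
        ENNReal.ofReal_le_ofReal (by linarith [Nat.ceil_lt_add_one hcN.le])

end Asymptotics

/-! ### The error exponent -/

section ErrorExponent

variable {X : Type*} [Fintype X]

lemma isThetaStar_iff {P Q : PMF X} {γ θ : ℝ} (hγ : 0 < γ) :
    IsThetaStar P Q γ θ ↔ 0 < θ ∧ gjs (mass Q) (mass P) θ⁻¹ = γ := by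
  have hiff : 0 < θ →
      (gjs (mass P) (mass Q) θ = γ * θ ↔ gjs (mass Q) (mass P) θ⁻¹ = γ) := fun hθ => by
    rw [gjs_eq_mul_gjs_inv hθ.ne', mul_comm γ, mul_right_inj' hθ.ne']
  exact ⟨fun ⟨_, hpos, h⟩ => ⟨hpos hγ, (hiff (hpos hγ)).1 h⟩,
    fun ⟨hθ, h⟩ => ⟨hθ.le, fun _ => hθ, (hiff hθ).2 h⟩⟩

lemma existsUnique_isThetaStar {P Q : PMF X} {γ : ℝ} (hγ : 0 < γ)
    (h : ChernoffSeparated γ (mass P) (mass Q)) : ∃! θ : ℝ, IsThetaStar P Q γ θ := by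
  obtain ⟨α, ⟨hα, hgjs⟩, huniq⟩ :=
    h.existsUnique_gjs_eq (mass_mem_stdSimplex P) (mass_mem_stdSimplex Q) hγ
  refine ⟨α⁻¹, (isThetaStar_iff hγ).2 ⟨inv_pos.2 hα, by rwa [inv_inv]⟩, fun θ hθ => ?_⟩
  obtain ⟨hθ0, hθ⟩ := (isThetaStar_iff hγ).1 hθ
  exact inv_eq_iff_eq_inv.1 (huniq θ⁻¹ ⟨inv_pos.2 hθ0, hθ⟩)

lemma coe_le_neg_log_div {p T : ENNReal} {a b r : ℝ} (hp : p ≤ ENNReal.ofReal (Real.exp (-a)))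
    (hT0 : T ≠ 0) (hT : T ≤ ENNReal.ofReal b) (hb : 0 ≤ b) (hr : 0 ≤ r) (h : r * b ≤ a) :
    (r : EReal) ≤ -ENNReal.log p / (T : EReal) := by
  have hlog : (a : EReal) ≤ -ENNReal.log p := by
    rw [EReal.le_neg, ← EReal.coe_neg, ← Real.log_exp (-a),
      ← ENNReal.log_ofReal_of_pos (Real.exp_pos _)]
    exact ENNReal.log_le_log hp
  have hTb : (T : EReal) ≤ (b : EReal) := by
    rw [← max_eq_left hb, ← EReal.coe_ennreal_ofReal]
    exact EReal.coe_ennreal_le_coe_ennreal_iff.2 hT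
  rw [EReal.le_div_iff_mul_le (EReal.coe_ennreal_pos.2 hT0.bot_lt)
    (mt EReal.coe_ennreal_eq_top_iff.1 (hT.trans_lt ENNReal.ofReal_lt_top).ne)]
  calc (r : EReal) * T ≤ r * b := mul_le_mul_of_nonneg_left hTb (by exact_mod_cast hr)
    _ ≤ a := by exact_mod_cast h
    _ ≤ -ENNReal.log p := hlog

variable [DecidableEq X] [MeasurableSpace X] {M : ℕ} {P : Fin M → PMF X} {γ c s t : ℝ} {i : Fin M}

lemma errExponent_nonneg (P : Fin M → PMF X) (γ : ℝ) (i : Fin M) : 0 ≤ errExponent P γ i := by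
  refine le_liminf_of_le (by isBoundedDefault) (Eventually.of_forall fun N => ?_)
  refine EReal.div_nonneg ?_ (EReal.coe_ennreal_nonneg _)
  rw [EReal.neg_nonneg, ENNReal.log_le_zero_iff]
  exact prob_le_one

variable [DiscreteMeasurableSpace X]

lemma tendsto_errProb (hγ : 0 < γ)
    (h : ∀ j ≠ i, ChernoffSeparated γ (mass (P j)) (mass (P i))) :
    Tendsto (errProb P γ i) atTop (𝓝 0) := by
  have hlim : Tendsto (fun N : ℕ => ENNReal.ofReal (Real.exp (-(γ / 2 * N)))) atTop (𝓝 0) := by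
    rw [← ENNReal.ofReal_zero]
    exact ENNReal.tendsto_ofReal (Real.tendsto_exp_neg_atTop_nhds_zero.comp
      (tendsto_natCast_atTop_atTop.const_mul_atTop (half_pos hγ)))
  exact tendsto_of_tendsto_of_tendsto_of_le_of_le' tendsto_const_nhds hlim
    (Eventually.of_forall fun _ => bot_le) (eventually_errProb_le h (half_lt_self hγ))

lemma div_le_errExponent_of_lt (hs0 : 0 ≤ s) (hs : s < γ) (hc : 0 < c)
    (h : ∀ j ≠ i, ChernoffSeparated γ (mass (P j)) (mass (P i)))
    (hgjs : ∀ j ≠ i, γ < gjs (mass (P i)) (mass (P j)) c) :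
    ((s / c : ℝ) : EReal) ≤ errExponent P γ i := by
  obtain ⟨s', hss', hs'⟩ := exists_between hs
  refine le_liminf_of_le (by isBoundedDefault) ?_
  filter_upwards [eventually_errProb_le h hs', eventually_expTime_le hc hgjs,
    eventually_gt_atTop 0, (tendsto_natCast_atTop_atTop.const_mul_atTop
      (sub_pos.2 hss')).eventually_ge_atTop (s / c * 2)] with N hP hT hN hsN
  refine coe_le_neg_log_div hP (one_pos.trans_le (one_le_expTime hN)).ne' hT (by positivity)
    (by positivity) ?_
  calc s / c * (c * N + 2) = s * N + s / c * 2 := by field_simp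
    _ ≤ s' * N := by linarith

lemma div_le_errExponent (hγ : 0 < γ) (hc : 0 < c)
    (h : ∀ j ≠ i, ChernoffSeparated γ (mass (P j)) (mass (P i)))
    (hgjs : ∀ j ≠ i, γ ≤ gjs (mass (P i)) (mass (P j)) c) :
    ((γ / c : ℝ) : EReal) ≤ errExponent P γ i := by
  have hcont : ContinuousAt (fun δ : ℝ => (γ - δ) / (c + δ)) 0 :=
    ContinuousAt.div (by fun_prop) (by fun_prop) (by simpa using hc.ne')
  have hlim : Tendsto (fun δ : ℝ => (((γ - δ) / (c + δ) : ℝ) : EReal)) (𝓝[>] 0)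
      (𝓝 ((γ / c : ℝ) : EReal)) := by
    refine (continuous_coe_real_ereal.tendsto _).comp ?_
    simpa only [sub_zero, add_zero] using hcont.tendsto.mono_left nhdsWithin_le_nhds
  refine le_of_tendsto hlim ?_
  filter_upwards [Ioo_mem_nhdsGT hγ] with δ hδ
  have hcδ : 0 < c + δ := add_pos hc hδ.1
  refine div_le_errExponent_of_lt (sub_nonneg.2 hδ.2.le) (sub_lt_self γ hδ.1) hcδ h
    fun j hj => (hgjs j hj).trans_lt ?_
  exact strictMonoOn_gjs (mass_mem_stdSimplex _) (mass_mem_stdSimplex _)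
    ((h j hj).ne (mass_mem_stdSimplex _) hγ).symm hc hcδ (lt_add_of_pos_right c hδ.1)

lemma mul_le_errExponent (hγ : 0 < γ) (ht : 0 < t)
    (h : ∀ j ≠ i, ChernoffSeparated γ (mass (P j)) (mass (P i))) {θ : Fin M → ℝ}
    (hθ : ∀ j ≠ i, IsThetaStar (P j) (P i) γ (θ j)) (htθ : ∀ j ≠ i, t ≤ θ j) :
    ((γ * t : ℝ) : EReal) ≤ errExponent P γ i := by
  rw [← div_inv_eq_mul]
  refine div_le_errExponent hγ (inv_pos.2 ht) h fun j hj => ?_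
  obtain ⟨hθ0, hgjs⟩ := (isThetaStar_iff hγ).1 (hθ j hj)
  rw [← hgjs]
  exact monotoneOn_gjs (mass_mem_stdSimplex _) (mass_mem_stdSimplex _) (inv_pos.2 hθ0)
    (inv_pos.2 ht) (inv_anti₀ ht (htθ j hj))

end ErrorExponent
end
end SeqClass

theorem corollary2_general {X : Type*} [Fintype X] [DecidableEq X] [MeasurableSpace X]
    [DiscreteMeasurableSpace X] {M : ℕ} (hM : 1 < M) (P : Fin M → PMF X) (γ : ℝ)
    (h : ∀ i j, i ≠ j → ChernoffSeparated γ (mass (P i)) (mass (P j))) :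
    (0 < γ → ∀ i j, i ≠ j → ∃! θ : ℝ, IsThetaStar (P j) (P i) γ θ) ∧
    (0 < γ → ∀ i, Tendsto (errProb P γ i) atTop (𝓝 0)) ∧
    ∀ θ : Fin M → Fin M → ℝ, (∀ i j, i ≠ j → IsThetaStar (P j) (P i) γ (θ i j)) →
      ∀ i, ((⨅ j : {j : Fin M // j ≠ i}, gjs (mass (P j)) (mass (P i)) (θ i j) : ℝ) : EReal) ≤
        errExponent P γ i := by
  refine ⟨fun hγ i j hij => existsUnique_isThetaStar hγ (h j i hij.symm),
    fun hγ i => tendsto_errProb hγ fun j hj => h j i hj, fun θ hθ i => ?_⟩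
  have : Nontrivial (Fin M) := Fin.nontrivial_iff_two_le.2 hM
  have : Nonempty {j // j ≠ i} := nonempty_subtype.2 (exists_ne i)
  have hgjs (j : {j // j ≠ i}) : gjs (mass (P j)) (mass (P i)) (θ i j) = γ * θ i j :=
    (hθ i j j.2.symm).2.2
  obtain ⟨k, hk⟩ := Finite.exists_min fun j : {j // j ≠ i} => θ i j
  obtain ⟨hk0, hkpos, -⟩ := hθ i k k.2.symm
  refine (EReal.coe_le_coe_iff.2 ((ciInf_le (Set.finite_range _).bddBelow k).trans_eq
    (hgjs k))).trans ?_
  rcases le_or_gt γ 0 with hγ | hγ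
  · exact (EReal.coe_nonpos.2 (mul_nonpos_of_nonpos_of_nonneg hγ hk0)).trans
      (errExponent_nonneg P γ i)
  · exact mul_le_errExponent hγ (hkpos hγ) (fun j hj => h j i hj)
      (fun j hj => hθ i j hj.symm) fun j hj => hk ⟨j, hj⟩

theorem corollary2 {X : Type*} [Fintype X] [DecidableEq X] [MeasurableSpace X]
    [DiscreteMeasurableSpace X] {M : ℕ} (hM : 2 < M) (P : Fin M → PMF X) (γ : ℝ) (hγ0 : 0 ≤ γ)
    (hγ : ∀ i j, i ≠ j → (γ : EReal) ≤ chernoff (P i) (P j))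
    (hsupp : ∀ i j, i ≠ j → (γ : EReal) = chernoff (P i) (P j) → (P i).support = (P j).support) :
    (0 < γ → ∀ i j, i ≠ j → ∃! θ : ℝ, IsThetaStar (P j) (P i) γ θ) ∧
    (0 < γ → ∀ i, Tendsto (errProb P γ i) atTop (𝓝 0)) ∧
    ∀ θ : Fin M → Fin M → ℝ, (∀ i j, i ≠ j → IsThetaStar (P j) (P i) γ (θ i j)) →
      ∀ i, ((⨅ j : {j : Fin M // j ≠ i}, gjs (mass (P j)) (mass (P i)) (θ i j) : ℝ) : EReal) ≤
        errExponent P γ i :=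
  corollary2_general (one_lt_two.trans hM) P γ fun i j hij =>
    chernoffSeparated_of_le_chernoff (hγ i j hij) (hsupp i j hij)
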